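/- Let $\Bbbk=\mathbb R$ or $\mathbb C$, and let $M$ be a smooth (for $\Bbbk=\mathbb C$: complex) $n$-dimensional manifold with a Frobenius structure of charge $d\in\Bbbk$. This means: every tangent space $T_xM$ carries, smoothly in $x$, a commutative associative product $\cdot$ with unity $e$ and a symmetric nondegenerate form $\langle\ ,\ \rangle$ with $\langle u\cdot v,w\rangle=\langle u,v\cdot w\rangle$; the metric $\langle\ ,\ \rangle$ is flat, with Levi-Civita connection $\nabla$, and $\nabla e=0$; with $c(x,y,z)=\langle x\cdot y,z\rangle$, the 4-tensor $(\nabla_wc)(x,y,z)$ is symmetric in $x,y,z,w$; and there is given a vector field $E$ with $\nabla\nabla E=0$, $$[E,x\cdot y]-[E,x]\cdot y-x\cdot[E,y]=x\cdot y,\qquad E\langle x,y\rangle-\langle[E,x],y\rangle-\langle x,[E,y]\rangle=(2-d)\langle x,y\rangle .$$ Transport the product to $T^*M$ by $\langle\ ,\ \rangle$. The intersection form on $T^*M$ is $(\omega_1,\omega_2)=i_E(\omega_1\cdot\omega_2)$, the discriminant $\Sigma\subset M$ is the set of points where it is degenerate, and on $M\setminus\Sigma$ the dual multiplication of tangent vectors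 is $u*v=\dfrac{u\cdot v}{E}$. Let $t^1,\dots,t^n$ be local flat coordinates of $\langle\ ,\ \rangle$, with $dt^\alpha\cdot dt^\beta=\sum_\gamma c^{\alpha\beta}_\gamma(t)\,dt^\gamma$, and let $p^1,\dots,p^n$ be local coordinates on $M\setminus\Sigma$ that are flat for the intersection form, i.e. $G^{ij}=(dp^i,dp^j)$ is constant. Let $V\subset\Bbbk^n$ be a nonempty convex open set of values of $p$ all of whose points lie in the domain of the coordinates $t$. Then $(G^{ij})$ is symmetric and nondegenerate; write $(G_{ij})=(G^{ij})^{-1}$. There is a smooth function $F_*(p)$ on $V$ such that on $V$ the following hold. 1. For all $i,j,k$, $$\frac{\partial^3F_*}{\partial p^i\partial p^j\partial p^k}=\sum_{a,b,\alpha,\beta,\gamma}G_{ia}G_{jb}\frac{\partial t^\gamma}{\partial p^k}\frac{\partial p^a}{\partial t^\alpha}\frac{\partial p^b}{\partial t^\beta}\,c^{\alpha\beta}_\gamma(t),$$ and the structure constants of the dual multiplication are given by $$\frac{\partial}{\partial p^i}*\frac{\partial}{\partial p^j}=\sum_{k,l}G^{kl}\frac{\partial^3F_*}{\partial p^l\partial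 p^i\partial p^j}\,\frac{\partial}{\partial p^k}.$$ 2. For all $i,j,k,l$, $$\sum_{a,b}\frac{\partial^3F_*}{\partial p^i\partial p^j\partial p^a}G^{ab}\frac{\partial^3F_*}{\partial p^b\partial p^k\partial p^l}=\sum_{a,b}\frac{\partial^3F_*}{\partial p^l\partial p^j\partial p^a}G^{ab}\frac{\partial^3F_*}{\partial p^b\partial p^k\partial p^i}.$$ 3. Let $d\neq1$. There is a constant vector $q\in\Bbbk^n$ such that $E(p^a)=\frac{1-d}2(p^a-q^a)$ for all $a$ and $$\sum_a(p^a-q^a)\frac{\partial F_*}{\partial p^a}=2F_*+\frac1{1-d}\sum_{a,b}G_{ab}(p^a-q^a)(p^b-q^b).$$ In particular, if the flat coordinates are normalized by $E(p^a)=\frac{1-d}2p^a$ for all $a$, then $$\sum_ap^a\frac{\partial F_*}{\partial p^a}=2F_*+\frac1{1-d}\sum_{a,b}G_{ab}p^ap^b.$$ -/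

import Mathlib

open scoped Manifold ContDiff

noncomputable section

namespace AlmostDuality

/-! ### Calculus in a coordinate domain of `𝕜ⁿ` -/

section Coordinates

variable {𝕜 : Type*} [RCLike 𝕜] {n : ℕ}

/-- The partial derivative `∂f/∂yⁱ` at `y`. -/
def pd (i : Fin n) (f : (Fin n → 𝕜) → 𝕜) (y : Fin n → 𝕜) : 𝕜 :=
  fderiv 𝕜 f y (Pi.single i 1)

/-- The Christoffel coefficients `Γ^γ_{αβ}` of the Levi-Civita connection of the metric with
Gram matrix `g = (g_{αβ})`. -/
def christoffel (g : (Fin n → 𝕜) → Matrix (Fin n) (Fin n) 𝕜) (γ α β : Fin n)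
    (y : Fin n → 𝕜) : 𝕜 :=
  (1 / 2) * ∑ δ, (g y)⁻¹ γ δ *
    (pd α (fun z => g z δ β) y + pd β (fun z => g z δ α) y - pd δ (fun z => g z α β) y)

/-- The curvature `R^δ_{γαβ}` of the Levi-Civita connection of `g`, that is, the coefficient of
`∂_δ` in `∇_α ∇_β ∂_γ - ∇_β ∇_α ∂_γ`. -/
def riemann (g : (Fin n → 𝕜) → Matrix (Fin n) (Fin n) 𝕜) (δ γ α β : Fin n)
    (y : Fin n → 𝕜) : 𝕜 :=
  pd α (christoffel g δ β γ) y - pd β (christoffel g δ α γ) y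
    + ∑ ε, christoffel g δ α ε y * christoffel g ε β γ y
    - ∑ ε, christoffel g δ β ε y * christoffel g ε α γ y

/-- `(∇_α X)^γ` for a vector field `X`. -/
def covVec (g : (Fin n → 𝕜) → Matrix (Fin n) (Fin n) 𝕜) (X : (Fin n → 𝕜) → (Fin n → 𝕜))
    (α γ : Fin n) (y : Fin n → 𝕜) : 𝕜 :=
  pd α (fun z => X z γ) y + ∑ ε, christoffel g γ α ε y * X y ε

/-- `(∇_α ∇_β X)^γ`, the second covariant derivative of a vector field `X`. -/
def covVec₂ (g : (Fin n → 𝕜) → Matrix (Fin n) (Fin n) 𝕜) (X : (Fin n → 𝕜) → (Fin n → 𝕜))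
    (α β γ : Fin n) (y : Fin n → 𝕜) : 𝕜 :=
  pd α (covVec g X β γ) y + ∑ ε, christoffel g γ α ε y * covVec g X β ε y
    - ∑ ε, christoffel g ε α β y * covVec g X ε γ y

/-- `∇_δ c_{αβγ}`, the covariant derivative of a tensor field with three lower indices. -/
def covThree (g : (Fin n → 𝕜) → Matrix (Fin n) (Fin n) 𝕜)
    (c : Fin n → Fin n → Fin n → (Fin n → 𝕜) → 𝕜) (δ α β γ : Fin n) (y : Fin n → 𝕜) : 𝕜 :=
  pd δ (c α β γ) y - ∑ ε, christoffel g ε δ α y * c ε β γ y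
    - ∑ ε, christoffel g ε δ β y * c α ε γ y - ∑ ε, christoffel g ε δ γ y * c α β ε y

end Coordinates

/-! ### Fields of Frobenius algebras on the tangent spaces of a manifold -/

/-- The tangent space at `x` of an `n`-dimensional manifold over `𝕜`. -/
abbrev Tan (𝕜 : Type*) [RCLike 𝕜] (n : ℕ) {M : Type*} [TopologicalSpace M]
    [ChartedSpace (Fin n → 𝕜) M] (x : M) : Type _ :=
  TangentSpace 𝓘(𝕜, Fin n → 𝕜) x

instance instFiniteDimensionalTan (𝕜 : Type*) [RCLike 𝕜] (n : ℕ) {M : Type*} [TopologicalSpace M]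
    [ChartedSpace (Fin n → 𝕜) M] (x : M) : FiniteDimensional 𝕜 (Tan 𝕜 n x) :=
  inferInstanceAs (FiniteDimensional 𝕜 (Fin n → 𝕜))

/-- A structure of a Frobenius algebra on every tangent space (`metric` is `< , >`, `mul` is the
product and `e` the unity), together with a vector field `E`. -/
structure FrobeniusField (𝕜 : Type*) [RCLike 𝕜] (n : ℕ) (M : Type*) [TopologicalSpace M]
    [ChartedSpace (Fin n → 𝕜) M] where
  metric : ∀ x : M, LinearMap.BilinForm 𝕜 (Tan 𝕜 n x)
  mul : ∀ x : M, Tan 𝕜 n x →ₗ[𝕜] Tan 𝕜 n x →ₗ[𝕜] Tan 𝕜 n x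
  e : ∀ x : M, Tan 𝕜 n x
  E : ∀ x : M, Tan 𝕜 n x
  metric_symm : ∀ x u v, metric x u v = metric x v u
  metric_nondegenerate : ∀ x, (metric x).Nondegenerate
  mul_comm : ∀ x u v, mul x u v = mul x v u
  mul_assoc : ∀ x u v w, mul x (mul x u v) w = mul x u (mul x v w)
  e_mul : ∀ x u, mul x (e x) u = u
  invariant : ∀ x u v w, metric x (mul x u v) w = metric x u (mul x v w)

section Charts

variable {𝕜 : Type*} [RCLike 𝕜] {n : ℕ} {M : Type*} [TopologicalSpace M]
  [ChartedSpace (Fin n → 𝕜) M]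

/-- The tangent vector at the point with coordinates `y` whose components in the chart `φ`
are `u`. -/
def vec (φ : OpenPartialHomeomorph M (Fin n → 𝕜)) (y u : Fin n → 𝕜) : Tan 𝕜 n (φ.symm y) :=
  mfderiv 𝓘(𝕜, Fin n → 𝕜) 𝓘(𝕜, Fin n → 𝕜) φ.symm y u

/-- The components in the chart `φ` of a tangent vector at `x`. -/
def components (φ : OpenPartialHomeomorph M (Fin n → 𝕜)) (x : M) :
    Tan 𝕜 n x →ₗ[𝕜] (Fin n → 𝕜) :=
  ContinuousLinearMap.toLinearMap (M₂ := Fin n → 𝕜)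
    (mfderiv 𝓘(𝕜, Fin n → 𝕜) 𝓘(𝕜, Fin n → 𝕜) φ x)

/-- The coordinate vector field `∂/∂φ^α` at the point with coordinates `y`. -/
def frame (φ : OpenPartialHomeomorph M (Fin n → 𝕜)) (α : Fin n) (y : Fin n → 𝕜) :
    Tan 𝕜 n (φ.symm y) :=
  vec φ y (Pi.single α 1)

/-- The differential `dφ^α` of a coordinate at `x`. -/
def dcoord (φ : OpenPartialHomeomorph M (Fin n → 𝕜)) (α : Fin n) (x : M) :
    Module.Dual 𝕜 (Tan 𝕜 n x) :=
  LinearMap.proj α ∘ₗ components φ x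

/-- The smooth local coordinate systems of the manifold. -/
def IsCoord (φ : OpenPartialHomeomorph M (Fin n → 𝕜)) : Prop :=
  φ ∈ IsManifold.maximalAtlas 𝓘(𝕜, Fin n → 𝕜) ∞ M

namespace FrobeniusField

variable (S : FrobeniusField 𝕜 n M)

/-- The Gram matrix `<∂_α, ∂_β>` of the metric in the coordinates `φ`. -/
def gram (φ : OpenPartialHomeomorph M (Fin n → 𝕜)) (y : Fin n → 𝕜) :
    Matrix (Fin n) (Fin n) 𝕜 :=
  Matrix.of fun α β => S.metric (φ.symm y) (frame φ α y) (frame φ β y)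

/-- The product of the vectors with components `u`, `v` at the point with coordinates `y`,
in components. -/
def coordMul (φ : OpenPartialHomeomorph M (Fin n → 𝕜)) (y u v : Fin n → 𝕜) : Fin n → 𝕜 :=
  components φ (φ.symm y) (S.mul (φ.symm y) (vec φ y u) (vec φ y v))

/-- The inner product of the vectors with components `u`, `v` at the point with
coordinates `y`. -/
def coordMetric (φ : OpenPartialHomeomorph M (Fin n → 𝕜)) (y u v : Fin n → 𝕜) : 𝕜 :=
  S.metric (φ.symm y) (vec φ y u) (vec φ y v)

/-- The structure constants `c_{αβ}^γ` in the coordinates `φ`. -/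
def structConst (φ : OpenPartialHomeomorph M (Fin n → 𝕜)) (α β γ : Fin n) (y : Fin n → 𝕜) : 𝕜 :=
  components φ (φ.symm y) (S.mul (φ.symm y) (frame φ α y) (frame φ β y)) γ

/-- The 3-tensor `c_{αβγ} = <∂_α · ∂_β, ∂_γ>` in the coordinates `φ`. -/
def threeTensor (φ : OpenPartialHomeomorph M (Fin n → 𝕜)) (α β γ : Fin n) (y : Fin n → 𝕜) : 𝕜 :=
  S.metric (φ.symm y) (S.mul (φ.symm y) (frame φ α y) (frame φ β y)) (frame φ γ y)

/-- The components of the unity vector field in the coordinates `φ`. -/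
def eComp (φ : OpenPartialHomeomorph M (Fin n → 𝕜)) (y : Fin n → 𝕜) : Fin n → 𝕜 :=
  components φ (φ.symm y) (S.e (φ.symm y))

/-- The components `E(φ^α)` of the Euler vector field in the coordinates `φ`. -/
def EComp (φ : OpenPartialHomeomorph M (Fin n → 𝕜)) (y : Fin n → 𝕜) : Fin n → 𝕜 :=
  components φ (φ.symm y) (S.E (φ.symm y))

/-- The axioms of a Frobenius manifold of charge `d`. All of them are tensorial; they are written
in the components of an arbitrary smooth local coordinate system `φ`, with the Levi-Civita
connection of the metric given by its Christoffel coefficients. -/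
structure IsFrobeniusManifold (S : FrobeniusField 𝕜 n M) (d : 𝕜) : Prop where
  smooth_metric : ∀ φ : OpenPartialHomeomorph M (Fin n → 𝕜), IsCoord φ →
    ∀ α β, ContDiffOn 𝕜 ∞ (fun y => S.gram φ y α β) φ.target
  smooth_mul : ∀ φ : OpenPartialHomeomorph M (Fin n → 𝕜), IsCoord φ →
    ∀ α β γ, ContDiffOn 𝕜 ∞ (S.structConst φ α β γ) φ.target
  smooth_e : ∀ φ : OpenPartialHomeomorph M (Fin n → 𝕜), IsCoord φ →
    ContDiffOn 𝕜 ∞ (S.eComp φ) φ.target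
  smooth_E : ∀ φ : OpenPartialHomeomorph M (Fin n → 𝕜), IsCoord φ →
    ContDiffOn 𝕜 ∞ (S.EComp φ) φ.target
  /-- The metric is flat. -/
  flat_metric : ∀ φ : OpenPartialHomeomorph M (Fin n → 𝕜), IsCoord φ → ∀ y ∈ φ.target,
    ∀ δ γ α β, riemann (S.gram φ) δ γ α β y = 0
  /-- `∇ e = 0`. -/
  flat_e : ∀ φ : OpenPartialHomeomorph M (Fin n → 𝕜), IsCoord φ → ∀ y ∈ φ.target,
    ∀ α γ, covVec (S.gram φ) (S.eComp φ) α γ y = 0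
  /-- The 4-tensor `(∇_w c)(x, y, z)` is symmetric in all its arguments (the three
  transpositions of neighbours are listed). -/
  symm_cov : ∀ φ : OpenPartialHomeomorph M (Fin n → 𝕜), IsCoord φ → ∀ y ∈ φ.target,
    ∀ δ α β γ,
      covThree (S.gram φ) (S.threeTensor φ) δ α β γ y
          = covThree (S.gram φ) (S.threeTensor φ) α δ β γ y ∧
      covThree (S.gram φ) (S.threeTensor φ) δ α β γ y
          = covThree (S.gram φ) (S.threeTensor φ) δ β α γ y ∧
      covThree (S.gram φ) (S.threeTensor φ) δ α β γ y
          = covThree (S.gram φ) (S.threeTensor φ) δ α γ β y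
  /-- `∇ ∇ E = 0`. -/
  linear_E : ∀ φ : OpenPartialHomeomorph M (Fin n → 𝕜), IsCoord φ → ∀ y ∈ φ.target,
    ∀ α β γ, covVec₂ (S.gram φ) (S.EComp φ) α β γ y = 0
  /-- `[E, X · Y] - [E, X] · Y - X · [E, Y] = X · Y` for local vector fields `X`, `Y`. -/
  euler_mul : ∀ φ : OpenPartialHomeomorph M (Fin n → 𝕜), IsCoord φ →
    ∀ X Y : (Fin n → 𝕜) → (Fin n → 𝕜),
      ContDiffOn 𝕜 ∞ X φ.target → ContDiffOn 𝕜 ∞ Y φ.target → ∀ y ∈ φ.target,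
      VectorField.lieBracket 𝕜 (S.EComp φ) (fun z => S.coordMul φ z (X z) (Y z)) y
        - S.coordMul φ y (VectorField.lieBracket 𝕜 (S.EComp φ) X y) (Y y)
        - S.coordMul φ y (X y) (VectorField.lieBracket 𝕜 (S.EComp φ) Y y)
        = S.coordMul φ y (X y) (Y y)
  /-- `E <X, Y> - <[E, X], Y> - <X, [E, Y]> = (2 - d) <X, Y>` for local vector fields
  `X`, `Y`. -/
  euler_metric : ∀ φ : OpenPartialHomeomorph M (Fin n → 𝕜), IsCoord φ →
    ∀ X Y : (Fin n → 𝕜) → (Fin n → 𝕜),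
      ContDiffOn 𝕜 ∞ X φ.target → ContDiffOn 𝕜 ∞ Y φ.target → ∀ y ∈ φ.target,
      fderiv 𝕜 (fun z => S.coordMetric φ z (X z) (Y z)) y (S.EComp φ y)
        - S.coordMetric φ y (VectorField.lieBracket 𝕜 (S.EComp φ) X y) (Y y)
        - S.coordMetric φ y (X y) (VectorField.lieBracket 𝕜 (S.EComp φ) Y y)
        = (2 - d) * S.coordMetric φ y (X y) (Y y)

/-- The isomorphism `v ↦ <v, ·>` between tangent and cotangent space. -/
def flat (x : M) : Tan 𝕜 n x ≃ₗ[𝕜] Module.Dual 𝕜 (Tan 𝕜 n x) :=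
  (S.metric x).toDual (S.metric_nondegenerate x)

/-- The product of covectors induced from the product of vectors by the metric. -/
def cotMul (x : M) (θ₁ θ₂ : Module.Dual 𝕜 (Tan 𝕜 n x)) : Module.Dual 𝕜 (Tan 𝕜 n x) :=
  S.flat x (S.mul x ((S.flat x).symm θ₁) ((S.flat x).symm θ₂))

/-- The intersection form `(θ₁, θ₂) = i_E (θ₁ · θ₂)` on the cotangent space. -/
def interForm (x : M) (θ₁ θ₂ : Module.Dual 𝕜 (Tan 𝕜 n x)) : 𝕜 :=
  S.cotMul x θ₁ θ₂ (S.E x)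

/-- The discriminant `Σ`: the points where the intersection form is degenerate. -/
def discriminant : Set M :=
  {x | ∃ θ : Module.Dual 𝕜 (Tan 𝕜 n x), θ ≠ 0 ∧ ∀ θ', S.interForm x θ θ' = 0}

/-- The dual multiplication `u * v = u · v / E`; the operator of multiplication by `E` is
invertible exactly outside the discriminant. -/
def star (x : M) (u v : Tan 𝕜 n x) : Tan 𝕜 n x :=
  Ring.inverse (S.mul x (S.E x) : Module.End 𝕜 (Tan 𝕜 n x)) (S.mul x u v)

/-- The coefficients `c^{αβ}_γ` of `dφ^α · dφ^β = ∑_γ c^{αβ}_γ dφ^γ`. -/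
def cotConst (φ : OpenPartialHomeomorph M (Fin n → 𝕜)) (α β γ : Fin n) (y : Fin n → 𝕜) : 𝕜 :=
  S.cotMul (φ.symm y) (dcoord φ α (φ.symm y)) (dcoord φ β (φ.symm y)) (frame φ γ y)

/-- The structure constants of the dual multiplication: the coefficient of `∂_γ`
in `∂_α * ∂_β`. -/
def starConst (φ : OpenPartialHomeomorph M (Fin n → 𝕜)) (α β γ : Fin n) (y : Fin n → 𝕜) : 𝕜 :=
  components φ (φ.symm y) (S.star (φ.symm y) (frame φ α y) (frame φ β y)) γ

/-- Flat coordinates of the metric `< , >`. -/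
def IsFlatCoord (φ : OpenPartialHomeomorph M (Fin n → 𝕜)) : Prop :=
  IsCoord φ ∧ ∃ η : Matrix (Fin n) (Fin n) 𝕜, ∀ y ∈ φ.target, S.gram φ y = η

/-- Flat coordinates of the intersection form on a part of the complement of the discriminant,
with constant Gram matrix `(dφⁱ, dφʲ) = Gⁱʲ`. -/
def IsInterFlatCoord (φ : OpenPartialHomeomorph M (Fin n → 𝕜))
    (G : Matrix (Fin n) (Fin n) 𝕜) : Prop :=
  IsCoord φ ∧ φ.source ⊆ S.discriminantᶜ ∧
    ∀ x ∈ φ.source, ∀ i j, S.interForm x (dcoord φ i x) (dcoord φ j x) = G i j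

end FrobeniusField

/-- `∂³F / ∂pⁱ ∂pʲ ∂pᵏ`. -/
def third (F : (Fin n → 𝕜) → 𝕜) (i j k : Fin n) (y : Fin n → 𝕜) : 𝕜 :=
  pd i (pd j (pd k F)) y

/-- `∂ψ^a / ∂φ^α` at the point with `φ`-coordinates `y`. -/
def jac (ψ φ : OpenPartialHomeomorph M (Fin n → 𝕜)) (a α : Fin n) (y : Fin n → 𝕜) : 𝕜 :=
  pd α (fun z => ψ (φ.symm z) a) y

end Charts

end AlmostDuality

end

open AlmostDuality

open scoped Manifold ContDiff

noncomputable section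

namespace AlmostDuality

/-! ### Integration: potentials of symmetric closed 3-tensors on convex open sets -/

section Potentials

variable {𝕜 : Type*} [RCLike 𝕜] {n : ℕ}

/-! Let `ξ a` be the gradient of `p^a` with respect to the flat metric, written in the flat
coordinates `t`, and let `H a` be its derivative, `A` the derivative of `E`. Constancy of `(dp^a,
dp^b) = <E · ξ a, ξ b>`, differentiated and combined with the Euler identities, forces the
Gauss–Manin system `E · H a w = -w · ((3-d)/2 ξ a - A (ξ a))` (`FlatJet.hessian_eq`). The argument
is the one that makes the Levi-Civita connection unique: the defect of this equation is
antisymmetric in one pair of indices and symmetric in another, hence zero.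

The system has two consequences. Since `H a w` is a multiple of `w` in the algebra, the one-form `<ξ
a · ξ b, ·>` is closed (`FlatJet.closed`); and `E(p^a)` has differential `(1-d)/2 dp^a`
(`FlatJet.euler_gradient`), so it is affine in `p`.

The rest is algebra in one tangent space (`IsDualFrame`). As `E · ξ a = ∑ G^{ab} ∂_b`, lowering the
index of `ξ` by `G` gives `∂_i / E`, so the tensor to be integrated is `<∂_i · ∂_j · ∂_k, e> / E²`.
This shows its total symmetry, its relation to the dual product, and the associativity equations.
Its contraction with `E` is `G_{jk}`.

A closed, totally symmetric 3-tensor on a convex set is a third derivative. For `d ≠ 1` the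
contraction with `E` allows the last two integrations to be replaced by explicit Euler-type
formulas, and the resulting potential satisfies the homogeneity equation exactly
(`exists_homogeneous_potential`). -/

theorem fderiv_eq_sum_pd (f : (Fin n → 𝕜) → 𝕜) (y v : Fin n → 𝕜) :
    fderiv 𝕜 f y v = ∑ k, v k * pd k f y := by
  conv_lhs => rw [pi_eq_sum_univ' v]
  simp only [map_sum, map_smul, smul_eq_mul, pd]

theorem pd_congr {V : Set (Fin n → 𝕜)} (hVo : IsOpen V) {f g : (Fin n → 𝕜) → 𝕜}
    (h : Set.EqOn f g V) {y : Fin n → 𝕜} (hy : y ∈ V) (i : Fin n) : pd i f y = pd i g y := by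
  unfold pd
  rw [Filter.EventuallyEq.fderiv_eq (h.eventuallyEq_of_mem (hVo.mem_nhds hy))]

theorem pd_eq_of_hasFDerivAt {f : (Fin n → 𝕜) → 𝕜} {f' : (Fin n → 𝕜) →L[𝕜] 𝕜} {y : Fin n → 𝕜}
    (h : HasFDerivAt f f' y) (i : Fin n) : pd i f y = f' (Pi.single i 1) := by
  rw [pd, h.fderiv]

theorem contDiffOn_of_pd {V : Set (Fin n → 𝕜)} (hVo : IsOpen V) {f : (Fin n → 𝕜) → 𝕜}
    {g : Fin n → (Fin n → 𝕜) → 𝕜} (hg : ∀ k, ContDiffOn 𝕜 ∞ (g k) V)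
    (hf : DifferentiableOn 𝕜 f V) (h : ∀ y ∈ V, ∀ k, pd k f y = g k y) :
    ContDiffOn 𝕜 ∞ f V := by
  rw [contDiffOn_infty_iff_fderiv_of_isOpen hVo]
  refine ⟨hf, ?_⟩
  have : ContDiffOn 𝕜 ∞ (fun y => ∑ k, g k y •
      (ContinuousLinearMap.proj k : (Fin n → 𝕜) →L[𝕜] 𝕜)) V :=
    ContDiffOn.sum fun k _ => (hg k).smul contDiffOn_const
  refine this.congr fun y hy => ?_
  ext v
  rw [fderiv_eq_sum_pd]
  simp [h y hy, mul_comm]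

/-- The Poincaré lemma for one-forms on a convex open subset of `𝕜ⁿ`, in components. -/
theorem exists_primitive {V : Set (Fin n → 𝕜)} (hVo : IsOpen V) (hVc : Convex ℝ V)
    {g : Fin n → (Fin n → 𝕜) → 𝕜} (hg : ∀ k, ContDiffOn 𝕜 ∞ (g k) V)
    (hcl : ∀ y ∈ V, ∀ k l, pd l (g k) y = pd k (g l) y) :
    ∃ f : (Fin n → 𝕜) → 𝕜, ContDiffOn 𝕜 ∞ f V ∧ ∀ y ∈ V, ∀ k, pd k f y = g k y := by
  set form : (Fin n → 𝕜) → (Fin n → 𝕜) →L[𝕜] 𝕜 := fun y => ∑ k, g k y •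
      (ContinuousLinearMap.proj k : (Fin n → 𝕜) →L[𝕜] 𝕜) with hform_def
  have hform : ContDiffOn 𝕜 ∞ form V := ContDiffOn.sum fun k _ => (hg k).smul contDiffOn_const
  have hform_d : DifferentiableOn 𝕜 form V := hform.differentiableOn (by simp)
  have hd : ∀ y ∈ V, ∀ u v, fderiv 𝕜 form y u v = ∑ k, ∑ l, u l * v k * pd l (g k) y := by
    intro y hy u v
    have hk : ∀ k, HasFDerivAt (g k) (fderiv 𝕜 (g k) y) y := fun k =>
      (((hg k).differentiableOn (by simp)).differentiableAt (hVo.mem_nhds hy)).hasFDerivAt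
    have : HasFDerivAt form (∑ k, (fderiv 𝕜 (g k) y).smulRight
        (ContinuousLinearMap.proj k : (Fin n → 𝕜) →L[𝕜] 𝕜)) y :=
      HasFDerivAt.fun_sum fun k _ =>
        HasFDerivAt.smul_const (F := (Fin n → 𝕜) →L[𝕜] 𝕜) (hk k) _
    rw [this.fderiv]
    simp only [sum_apply, ContinuousLinearMap.smulRight_apply,
      smul_apply, ContinuousLinearMap.proj_apply, smul_eq_mul,
      fderiv_eq_sum_pd, Finset.sum_mul]
    exact Finset.sum_congr rfl fun k _ => Finset.sum_congr rfl fun l _ => by ring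
  -- Convexity is real, so symmetry of the derivative is checked for the real derivative, which is
  -- the 𝕜-derivative with scalars restricted.
  obtain ⟨f, hf⟩ := hVc.exists_forall_hasFDerivAt_of_fderiv_symmetric (𝕜 := 𝕜) hVo
    (hform_d.restrictScalars ℝ) (by
      intro y hy u v
      have := (hform_d.differentiableAt (hVo.mem_nhds hy)).fderiv_restrictScalars ℝ
      rw [this]
      simp only [ContinuousLinearMap.coe_restrictScalars']
      rw [hd y hy, hd y hy, Finset.sum_comm]
      exact Finset.sum_congr rfl fun k _ => Finset.sum_congr rfl fun l _ => by
        rw [hcl y hy]; ring)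
  have hpd : ∀ y ∈ V, ∀ k, pd k f y = g k y := by
    intro y hy k
    rw [pd_eq_of_hasFDerivAt (hf y hy)]
    simp [hform_def, Pi.single_apply]
  exact ⟨f, contDiffOn_of_pd hVo hg
    (fun y hy => (hf y hy).differentiableAt.differentiableWithinAt) hpd, hpd⟩

/-- A closed symmetric family of one-forms with values in symmetric matrices has a symmetric
matrix of primitives. -/
theorem exists_symm_primitives {V : Set (Fin n → 𝕜)} (hVo : IsOpen V) (hVc : Convex ℝ V)
    {Φ : Fin n → Fin n → Fin n → (Fin n → 𝕜) → 𝕜}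
    (hΦ : ∀ i j k, ContDiffOn 𝕜 ∞ (Φ i j k) V)
    (h12 : ∀ y ∈ V, ∀ i j k, Φ i j k y = Φ j i k y)
    (hcl : ∀ y ∈ V, ∀ i j k l, pd l (Φ i j k) y = pd k (Φ i j l) y) :
    ∃ h : Fin n → Fin n → (Fin n → 𝕜) → 𝕜, (∀ i j, ContDiffOn 𝕜 ∞ (h i j) V) ∧
      (∀ i j, h i j = h j i) ∧ ∀ y ∈ V, ∀ i j k, pd k (h i j) y = Φ i j k y := by
  choose P hP hPd using fun i j =>
    exists_primitive hVo hVc (hΦ i j) (fun y hy k l => hcl y hy i j k l)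
  -- Primitives of `Φ i j` and `Φ j i` may differ by a constant; averaging makes the matrix exactly
  -- symmetric, which is the closedness needed for the next integration.
  refine ⟨fun i j y => (1 / 2) * (P i j y + P j i y), fun i j =>
    contDiffOn_const.mul ((hP i j).add (hP j i)), fun i j => by ext y; ring, ?_⟩
  intro y hy i j k
  have hd : ∀ i j, HasFDerivAt (P i j) (fderiv 𝕜 (P i j) y) y := fun i j =>
    (((hP i j).differentiableOn (by simp)).differentiableAt (hVo.mem_nhds hy)).hasFDerivAt
  refine (pd_eq_of_hasFDerivAt (((hd i j).add (hd j i)).const_mul (1 / 2)) k).trans ?_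
  have e1 := hPd i j y hy k
  have e2 := hPd j i y hy k
  simp only [pd] at e1 e2
  simp only [smul_apply, add_apply, e1, e2,
    h12 y hy j i k, smul_eq_mul]
  ring

/-- `third F i j k` differentiates in `k` first, so the chain of primitives produces `Φ k j i`;
`hsymm` restores the order. -/
theorem third_of_pd {V : Set (Fin n → 𝕜)} (hVo : IsOpen V)
    {Φ : Fin n → Fin n → Fin n → (Fin n → 𝕜) → 𝕜} {h : Fin n → Fin n → (Fin n → 𝕜) → 𝕜}
    {f : Fin n → (Fin n → 𝕜) → 𝕜} {F : (Fin n → 𝕜) → 𝕜}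
    (hsymm : ∀ y ∈ V, ∀ i j k, Φ k j i y = Φ i j k y)
    (hh : ∀ y ∈ V, ∀ i j k, pd k (h i j) y = Φ i j k y)
    (hf : ∀ y ∈ V, ∀ i j, pd j (f i) y = h i j y)
    (hF : ∀ y ∈ V, ∀ i, pd i F y = f i y) :
    ∀ y ∈ V, ∀ i j k, third F i j k y = Φ i j k y := by
  intro y hy i j k
  unfold third
  rw [pd_congr hVo (g := h k j) (fun z hz => ?_) hy, hh y hy, hsymm y hy]
  rw [pd_congr hVo (g := f k) (fun w hw => hF w hw k) hz, hf z hz]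

/-- Three successive applications of the Poincaré lemma, each closedness condition coming from a
symmetry of the previous stage. This version serves the case `d = 1`, where no homogeneity is
claimed. -/
theorem exists_potential {V : Set (Fin n → 𝕜)} (hVo : IsOpen V) (hVc : Convex ℝ V)
    {Φ : Fin n → Fin n → Fin n → (Fin n → 𝕜) → 𝕜}
    (hΦ : ∀ i j k, ContDiffOn 𝕜 ∞ (Φ i j k) V)
    (h12 : ∀ y ∈ V, ∀ i j k, Φ i j k y = Φ j i k y)
    (h23 : ∀ y ∈ V, ∀ i j k, Φ i j k y = Φ i k j y)
    (hcl : ∀ y ∈ V, ∀ i j k l, pd l (Φ i j k) y = pd k (Φ i j l) y) :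
    ∃ F : (Fin n → 𝕜) → 𝕜, ContDiffOn 𝕜 ∞ F V ∧
      ∀ y ∈ V, ∀ i j k, third F i j k y = Φ i j k y := by
  obtain ⟨h, hC, hsymm, hh⟩ := exists_symm_primitives hVo hVc hΦ h12 hcl
  choose f hf hfd using fun i => exists_primitive hVo hVc (hC i)
    (fun y hy k l => by rw [hh y hy, hh y hy, h23 y hy])
  obtain ⟨F, hF, hFd⟩ := exists_primitive hVo hVc hf
    (fun y hy k l => by rw [hfd k y hy, hfd l y hy, hsymm])
  exact ⟨F, hF, third_of_pd hVo
    (fun y hy i j k => by rw [h12 y hy k, h23 y hy j k i, h12 y hy]) hh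
    (fun y hy i j => hfd i y hy j) hFd⟩

theorem hasFDerivAt_coord_sub (q : Fin n → 𝕜) (a : Fin n) (y : Fin n → 𝕜) :
    HasFDerivAt (fun z : Fin n → 𝕜 => z a - q a)
      (ContinuousLinearMap.proj a : (Fin n → 𝕜) →L[𝕜] 𝕜) y :=
  (ContinuousLinearMap.proj a : (Fin n → 𝕜) →L[𝕜] 𝕜).hasFDerivAt.sub_const _

theorem contDiff_coord_sub (q : Fin n → 𝕜) (a : Fin n) :
    ContDiff 𝕜 ∞ (fun z : Fin n → 𝕜 => z a - q a) :=
  (ContinuousLinearMap.proj a : (Fin n → 𝕜) →L[𝕜] 𝕜).contDiff.sub contDiff_const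

/-- A potential which is homogeneous of degree two around `q`, up to a quadratic form. -/
theorem exists_homogeneous_potential {V : Set (Fin n → 𝕜)} (hVo : IsOpen V) (hVc : Convex ℝ V)
    {Φ : Fin n → Fin n → Fin n → (Fin n → 𝕜) → 𝕜}
    (hΦ : ∀ i j k, ContDiffOn 𝕜 ∞ (Φ i j k) V)
    (h12 : ∀ y ∈ V, ∀ i j k, Φ i j k y = Φ j i k y)
    (h23 : ∀ y ∈ V, ∀ i j k, Φ i j k y = Φ i k j y)
    (hcl : ∀ y ∈ V, ∀ i j k l, pd l (Φ i j k) y = pd k (Φ i j l) y)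
    (q : Fin n → 𝕜) (N : Matrix (Fin n) (Fin n) 𝕜) (hN : ∀ i j, N i j = N j i) (s : 𝕜)
    (hhom : ∀ y ∈ V, ∀ j k, ∑ i, (y i - q i) * Φ i j k y = 2 * s * N j k) :
    ∃ F : (Fin n → 𝕜) → 𝕜, ContDiffOn 𝕜 ∞ F V ∧
      (∀ y ∈ V, ∀ i j k, third F i j k y = Φ i j k y) ∧
      ∀ y ∈ V, ∑ a, (y a - q a) * pd a F y =
        2 * F y + s * ∑ a, ∑ b, N a b * (y a - q a) * (y b - q b) := by
  obtain ⟨h, hC, hsymm, hh⟩ := exists_symm_primitives hVo hVc hΦ h12 hcl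
  have h13 : ∀ y ∈ V, ∀ i j k, Φ k j i y = Φ i j k y :=
    fun y hy i j k => by rw [h12 y hy k, h23 y hy j k i, h12 y hy]
  -- The gradient is written down from the Hessian `h` by Euler's formula instead of being
  -- integrated: by `hhom`, the derivative of the first sum exceeds `h j k` by `2 s N j k`, which
  -- the linear term removes. This fixes the constants of integration.
  set f : Fin n → (Fin n → 𝕜) → 𝕜 := fun j y =>
    ∑ a, (y a - q a) * h j a y - 2 * s * ∑ a, N j a * (y a - q a) with hfdef
  have hfC : ∀ j, ContDiffOn 𝕜 ∞ (f j) V := fun j =>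
    (ContDiffOn.sum fun a _ => (contDiff_coord_sub q a).contDiffOn.mul (hC j a)).sub
      (contDiffOn_const.mul (ContDiffOn.sum fun a _ =>
        contDiffOn_const.mul (contDiff_coord_sub q a).contDiffOn))
  have hfd : ∀ y ∈ V, ∀ j k, pd k (f j) y = h j k y := by
    intro y hy j k
    have hd : ∀ a, HasFDerivAt (h j a) (fderiv 𝕜 (h j a) y) y := fun a =>
      (((hC j a).differentiableOn (by simp)).differentiableAt (hVo.mem_nhds hy)).hasFDerivAt
    have := (HasFDerivAt.fun_sum (u := Finset.univ) fun a _ =>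
      (hasFDerivAt_coord_sub q a y).mul (hd a)).sub
      ((HasFDerivAt.fun_sum (u := Finset.univ) fun a _ =>
        (hasFDerivAt_coord_sub q a y).const_mul (N j a)).const_mul (2 * s))
    refine (pd_eq_of_hasFDerivAt this k).trans ?_
    have e : ∀ a, (fderiv 𝕜 (h j a) y) (Pi.single k 1) = Φ a j k y := fun a => by
      rw [h12 y hy]; exact hh y hy j a k
    simp [e, Pi.single_apply, Finset.sum_add_distrib, hhom y hy]
  -- This is the homogeneity equation solved for `F`, so only `∂_k F = f k` has to be verified.
  set F : (Fin n → 𝕜) → 𝕜 := fun y => (1 / 2) * (∑ a, (y a - q a) * f a y -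
    s * ∑ a, ∑ b, N a b * (y a - q a) * (y b - q b)) with hFdef
  have hFC : ContDiffOn 𝕜 ∞ F V :=
    contDiffOn_const.mul
      ((ContDiffOn.sum fun a _ => (contDiff_coord_sub q a).contDiffOn.mul (hfC a)).sub
      (contDiffOn_const.mul (ContDiffOn.sum fun a _ => ContDiffOn.sum fun b _ =>
        (contDiffOn_const.mul (contDiff_coord_sub q a).contDiffOn).mul
          (contDiff_coord_sub q b).contDiffOn)))
  have hFd : ∀ y ∈ V, ∀ k, pd k F y = f k y := by
    intro y hy k
    have hd : ∀ a, HasFDerivAt (f a) (fderiv 𝕜 (f a) y) y := fun a =>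
      (((hfC a).differentiableOn (by simp)).differentiableAt (hVo.mem_nhds hy)).hasFDerivAt
    have := ((HasFDerivAt.fun_sum (u := Finset.univ) fun a _ =>
      (hasFDerivAt_coord_sub q a y).mul (hd a)).sub
      ((HasFDerivAt.fun_sum (u := Finset.univ) fun a _ =>
        HasFDerivAt.fun_sum (u := Finset.univ) fun b _ =>
        ((hasFDerivAt_coord_sub q a y).const_mul (N a b)).mul
          (hasFDerivAt_coord_sub q b y)).const_mul s)).const_mul (1 / 2)
    refine (pd_eq_of_hasFDerivAt this k).trans ?_
    have e : ∀ a, (fderiv 𝕜 (f a) y) (Pi.single k 1) = h k a y := fun a => by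
      rw [hsymm]; exact hfd y hy a k
    have e2 : ∑ a, (y a - q a) * h k a y = f k y + 2 * s * ∑ a, N k a * (y a - q a) := by
      rw [hfdef]; ring
    have e3 : ∑ a, N a k * (y a - q a) = ∑ a, N k a * (y a - q a) :=
      Finset.sum_congr rfl fun a _ => by rw [hN]
    simp [e, Pi.single_apply, Finset.sum_add_distrib, e2, mul_assoc]
    simp [← mul_assoc, mul_comm _ (N _ _), e3]
    ring
  refine ⟨F, hFC, third_of_pd hVo h13 hh hfd hFd, fun y hy => ?_⟩
  rw [Finset.sum_congr rfl fun a _ => by rw [hFd y hy]]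
  rw [hFdef]
  ring

end Potentials

/-! ### Pointwise differential identities: the Gauss–Manin system and its consequences -/

section Infinitesimal

variable {𝕜 : Type*} [RCLike 𝕜] {W : Type*} [NormedAddCommGroup W] [NormedSpace 𝕜 W]

/-- The value and the first derivatives, at a point and in flat coordinates, of the structures of
a Frobenius manifold (the metric `η`, the product `m` with derivative `c'`, the Euler field `E`
with derivative `A`) and of a family of gradients `ξ` with Hessians `H` whose pairwise products in
the intersection form are stationary. -/
structure FlatJet {ι : Type*} (η : W →L[𝕜] W →L[𝕜] 𝕜) (m : W →L[𝕜] W →L[𝕜] W)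
    (c' : W →L[𝕜] W →L[𝕜] W →L[𝕜] W) (A : W →L[𝕜] W) (E e : W) (d : 𝕜)
    (ξ : ι → W) (H : ι → W →L[𝕜] W) : Prop where
  symm : ∀ u v, η u v = η v u
  comm : ∀ u v, m u v = m v u
  assoc : ∀ u v w, m (m u v) w = m u (m v w)
  unit : ∀ u, m e u = u
  inv : ∀ u v w, η (m u v) w = η u (m v w)
  cov₁₂ : ∀ w u v z, η (c' w u v) z = η (c' u w v) z
  cov₁₄ : ∀ w u v z, η (c' w u v) z = η (c' z u v) w
  euler : ∀ u v, c' E u v - A (m u v) + m (A u) v + m u (A v) = m u v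
  conformal : ∀ u v, η (A u) v + η u (A v) = (2 - d) * η u v
  hess : ∀ a w v, η (H a w) v = η (H a v) w
  compat : ∀ a b w, η (m (A w) (ξ a)) (ξ b) + η (c' w E (ξ a)) (ξ b) + η (m E (H a w)) (ξ b)
    + η (m E (ξ a)) (H b w) = 0
  span : Submodule.span 𝕜 (Set.range fun c => m E (ξ c)) = ⊤
  sep : ∀ z, (∀ b, η z (ξ b) = 0) → z = 0

namespace FlatJet

variable {ι : Type*} {η : W →L[𝕜] W →L[𝕜] 𝕜} {m : W →L[𝕜] W →L[𝕜] W}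
    {c' : W →L[𝕜] W →L[𝕜] W →L[𝕜] W} {A : W →L[𝕜] W} {E e : W} {d : 𝕜}
    {ξ : ι → W} {H : ι → W →L[𝕜] W}

theorem left_comm (h : FlatJet η m c' A E e d ξ H) (u v w : W) :
    m u (m v w) = m v (m u w) := by
  rw [← h.assoc, h.comm u v, h.assoc]

/-- The form is the unit functional evaluated on the product. -/
theorem form_eq (h : FlatJet η m c' A E e d ξ H) (u v : W) : η u v = η e (m u v) := by
  rw [← h.inv, h.unit]

/-- The Gauss–Manin system satisfied by the gradients of the flat coordinates of the
intersection form. -/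
theorem hessian_eq (h : FlatJet η m c' A E e d ξ H) (a : ι) (w : W) :
    m E (H a w) = - m w (((3 - d) / 2) • ξ a - A (ξ a)) := by
  -- `D a b w` is the defect of the claimed equation, paired with `ξ b`.
  set D : ι → ι → W → 𝕜 := fun a b w =>
    η (m E (H a w) + m w (((3 - d) / 2) • ξ a - A (ξ a))) (ξ b) with hD
  -- The symmetrised defect is the derivative of `<E · ξ a, ξ b>`, rewritten with the Euler
  -- identities for the product and the metric; the constant `(3-d)/2` is half of `1 + (2-d)`, the
  -- sum of their weights.
  have hanti : ∀ a b w, D a b w = - D b a w := by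
    intro a b w
    have h1 := h.compat a b w
    have h2 := congrArg (fun z => η z (ξ b)) (h.euler w (ξ a))
    have h3 := h.conformal (m w (ξ a)) (ξ b)
    have h4 : η (m w (A (ξ b))) (ξ a) = η (m w (ξ a)) (A (ξ b)) := by
      rw [h.inv, h.inv, h.comm]
    have h5 : η (m E (H b w)) (ξ a) = η (m E (ξ a)) (H b w) := by
      rw [h.inv, h.inv, h.comm]
    have h6 : η (m w (ξ b)) (ξ a) = η (m w (ξ a)) (ξ b) := by
      rw [h.inv, h.inv, h.comm]
    rw [h.cov₁₂] at h1
    simp only [map_add, map_sub, add_apply, sub_apply] at h2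
    simp only [hD, map_add, map_sub, add_apply, sub_apply, map_smul, smul_apply, smul_eq_mul,
      h4, h5, h6]
    linear_combination h1 - h2 - h3
  -- The first term is the symmetric Hessian on `E · ξ c` and `E · ξ b`; the second is a product of
  -- commuting factors.
  have hsymm : ∀ a b c, D a b (m E (ξ c)) = D a c (m E (ξ b)) := by
    intro a b c
    simp only [hD, map_add, add_apply]
    congr 1
    · rw [h.comm, h.inv, h.hess, ← h.inv, h.comm]
    · rw [h.form_eq (m (m E (ξ c)) _), h.form_eq (m (m E (ξ b)) _)]
      congr 1
      simp only [h.assoc, h.comm, h.left_comm]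
  have hzero : ∀ a b c, D a b (m E (ξ c)) = 0 := by
    intro a b c
    -- Three rounds of the two transpositions return the indices to their places, with total sign
    -- `(-1)³`.
    have : D a b (m E (ξ c)) = - D a b (m E (ξ c)) := by
      conv_lhs => rw [hsymm, hanti, hsymm, hanti, hsymm, hanti]
      ring
    exact self_eq_neg.mp this
  have hall : ∀ a b w, D a b w = 0 := by
    intro a b w
    have hw : w ∈ Submodule.span 𝕜 (Set.range fun c => m E (ξ c)) := h.span ▸ Submodule.mem_top
    induction hw using Submodule.span_induction with
    | mem x hx => obtain ⟨c, rfl⟩ := hx; exact hzero a b c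
    | zero => simp [hD]
    | add x y _ _ hx hy =>
      simp only [hD, map_add, add_apply] at hx hy ⊢
      linear_combination hx + hy
    | smul r x _ hx =>
      simp only [hD, map_add, add_apply, map_smul, smul_apply, smul_eq_mul] at hx ⊢
      linear_combination r * hx
  exact eq_neg_of_add_eq_zero_left (h.sep _ fun b => hall a b w)

theorem mul_euler_surjective (h : FlatJet η m c' A E e d ξ H) (v : W) : ∃ u, m E u = v := by
  have hv : v ∈ Submodule.span 𝕜 (Set.range fun c => m E (ξ c)) := h.span ▸ Submodule.mem_top
  have : Submodule.span 𝕜 (Set.range fun c => m E (ξ c)) ≤ (m E : W →ₗ[𝕜] W).range :=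
    Submodule.span_le.mpr (by rintro _ ⟨c, rfl⟩; exact ⟨ξ c, rfl⟩)
  exact this hv

/-- Morally `H a w = -w · X / E` with `X` independent of `w`, so the pairing depends on `w · v`
only. Division by `E` is avoided by writing both vectors as multiples of `E`. -/
theorem hessian_mul_symm (h : FlatJet η m c' A E e d ξ H) (a b : ι) (w v : W) :
    η (m (H a w) (ξ b)) v = η (m (H a v) (ξ b)) w := by
  obtain ⟨w, rfl⟩ := h.mul_euler_surjective w
  obtain ⟨v, rfl⟩ := h.mul_euler_surjective v
  have key : ∀ u v, η (m (H a u) (ξ b)) (m E v) =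
      - η e (m u (m (((3 - d) / 2) • ξ a - A (ξ a)) (m (ξ b) v))) := by
    intro u v
    have : m (m (H a u) (ξ b)) (m E v) = m (m E (H a u)) (m (ξ b) v) := by
      simp only [h.assoc, h.comm, h.left_comm]
    rw [h.form_eq, this, h.hessian_eq]
    simp only [map_neg, neg_apply, h.assoc]
  rw [key, key]
  congr 2
  simp only [h.assoc, h.comm, h.left_comm]

/-- The one-form `w ↦ <ξ_a · ξ_b, w>` is closed. -/
theorem closed (h : FlatJet η m c' A E e d ξ H) (a b : ι) (w v : W) :
    η (c' w (ξ a) (ξ b) + m (H a w) (ξ b) + m (ξ a) (H b w)) v =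
      η (c' v (ξ a) (ξ b) + m (H a v) (ξ b) + m (ξ a) (H b v)) w := by
  simp only [map_add, add_apply]
  rw [h.cov₁₄, h.hessian_mul_symm a, h.comm (ξ a) (H b w), h.hessian_mul_symm b, h.comm (ξ a)]

/-- The derivative of `<ξ_a, E>`. -/
theorem euler_gradient (h : FlatJet η m c' A E e d ξ H) (a : ι) (w : W) :
    η (H a w) E + η (ξ a) (A w) = (1 - d) / 2 * η (ξ a) w := by
  have h1 : η (H a w) E = η e (m E (H a w)) := by rw [h.form_eq, h.comm]
  have h2 := h.conformal (ξ a) w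
  have h3 : η e (m w (ξ a)) = η (ξ a) w := by rw [h.symm (ξ a), ← h.form_eq]
  have h4 : η e (m w (A (ξ a))) = η (A (ξ a)) w := by rw [h.symm (A (ξ a)), ← h.form_eq]
  rw [h1, h.hessian_eq]
  simp only [map_neg, map_sub, map_smul, smul_eq_mul, h3, h4]
  linear_combination h2

end FlatJet

end Infinitesimal

/-! ### Algebra in one tangent space: the dual product and its 3-tensor -/

section Algebra

open scoped Matrix

/-- The vector `∑ₐ Gᵢₐ Zᵃ`. -/
def dualVec {𝕜 T : Type*} [Field 𝕜] [AddCommGroup T] [Module 𝕜 T] {n : ℕ}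
    (Z : Fin n → T) (G : Matrix (Fin n) (Fin n) 𝕜) (i : Fin n) : T :=
  ∑ a, G⁻¹ i a • Z a

/-- A commutative Frobenius algebra with a vector `E` defining a nondegenerate intersection form,
a basis `X` with dual basis `θ`, the vectors `Z` dual to `θ`, and the Gram matrix `G` of `θ`
in the intersection form. -/
structure IsDualFrame {𝕜 T : Type*} [Field 𝕜] [AddCommGroup T] [Module 𝕜 T] {n : ℕ}
    (η : LinearMap.BilinForm 𝕜 T) (m : T →ₗ[𝕜] T →ₗ[𝕜] T) (e E : T)
    (X Z : Fin n → T) (θ : Fin n → Module.Dual 𝕜 T) (G : Matrix (Fin n) (Fin n) 𝕜) : Prop where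
  symm : ∀ u v, η u v = η v u
  comm : ∀ u v, m u v = m v u
  assoc : ∀ u v w, m (m u v) w = m u (m v w)
  unit : ∀ u, m e u = u
  inv : ∀ u v w, η (m u v) w = η u (m v w)
  expand : ∀ v, ∑ a, θ a v • X a = v
  dual : ∀ a b, θ a (X b) = if a = b then 1 else 0
  sharp : ∀ a v, η (Z a) v = θ a v
  nondeg : ∀ z, (∀ z', η (m z z') E = 0) → z = 0
  gram : ∀ a b, η (m (Z a) (Z b)) E = G a b

namespace IsDualFrame

variable {𝕜 T : Type*} [Field 𝕜] [AddCommGroup T] [Module 𝕜 T] {n : ℕ}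
    {η : LinearMap.BilinForm 𝕜 T} {m : T →ₗ[𝕜] T →ₗ[𝕜] T} {e E : T}
    {X Z : Fin n → T} {θ : Fin n → Module.Dual 𝕜 T} {G : Matrix (Fin n) (Fin n) 𝕜}

theorem left_comm (h : IsDualFrame η m e E X Z θ G) (u v w : T) : m u (m v w) = m v (m u w) := by
  rw [← h.assoc, h.comm u v, h.assoc]

theorem form_eq (h : IsDualFrame η m e E X Z θ G) (u v : T) : η u v = η e (m u v) := by
  rw [← h.inv, h.unit]

theorem isSymm (h : IsDualFrame η m e E X Z θ G) : G.IsSymm := by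
  ext a b
  rw [Matrix.transpose_apply, ← h.gram, ← h.gram, h.comm]

/-- The `X b`-coefficient of `E · Z a` is `θ b (E · Z a) = <Z b, E · Z a>`, an entry of `G`. -/
theorem mul_sharp (h : IsDualFrame η m e E X Z θ G) (a : Fin n) :
    m E (Z a) = ∑ b, G a b • X b := by
  rw [← h.expand (m E (Z a))]
  refine Finset.sum_congr rfl fun b _ => ?_
  rw [← h.sharp, ← h.inv, ← h.gram, h.form_eq, h.form_eq (m (Z a) (Z b))]
  congr 2
  simp only [h.assoc, h.comm, h.left_comm]

theorem form_nondeg (h : IsDualFrame η m e E X Z θ G) (z : T) (hz : ∀ v, η z v = 0) : z = 0 :=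
  h.nondeg z fun z' => by rw [h.inv]; exact hz _

theorem sum_form_smul (h : IsDualFrame η m e E X Z θ G) (v : T) :
    ∑ a, η v (X a) • Z a = v := by
  refine sub_eq_zero.mp (h.form_nondeg _ fun w => ?_)
  conv_lhs => rw [← h.expand w]
  simp [map_sum, h.sharp, h.dual]

/-- A kernel vector of `G` gives a combination of the `Z a` in the kernel of the intersection form,
hence zero; pairing it with the `X b` recovers the coefficients. -/
theorem isUnit_det (h : IsDualFrame η m e E X Z θ G) : IsUnit G.det := by
  rw [isUnit_iff_ne_zero]
  intro hdet
  obtain ⟨v, hv, hGv⟩ := Matrix.exists_vecMul_eq_zero_iff.mpr hdet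
  have hz : ∑ a, v a • Z a = 0 := by
    refine h.nondeg _ fun z' => ?_
    rw [h.inv, ← h.sum_form_smul z']
    have : ∀ b, ∑ a, v a * G a b = 0 := fun b => congrFun hGv b
    simp only [map_sum, map_smul, LinearMap.sum_apply, LinearMap.smul_apply, smul_eq_mul,
      ← h.inv, h.gram]
    simp [mul_comm (η _ _), this]
  refine hv (funext fun b => ?_)
  have h2 : η (∑ a, v a • Z a) (X b) = v b := by
    simp [map_sum, LinearMap.sum_apply, h.sharp, h.dual]
  rw [← h2, hz]
  simp

/-- The quotient `X i / E`. -/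
theorem mul_quotient (h : IsDualFrame η m e E X Z θ G) (i : Fin n) :
    m E (dualVec Z G i) = X i := by
  simp only [dualVec, map_sum, map_smul, h.mul_sharp, Finset.smul_sum, smul_smul]
  rw [Finset.sum_comm]
  simp only [← Finset.sum_smul, ← Matrix.mul_apply, Matrix.nonsing_inv_mul _ h.isUnit_det]
  simp [Matrix.one_apply]

theorem exists_sum_mul_sharp (h : IsDualFrame η m e E X Z θ G) (u : T) :
    ∃ c : Fin n → 𝕜, ∑ a, c a • m E (Z a) = u := by
  obtain ⟨v, rfl⟩ : ∃ v, m E v = u :=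
    ⟨∑ a, θ a u • dualVec Z G a, by simp only [map_sum, map_smul, h.mul_quotient, h.expand]⟩
  refine ⟨fun a => η v (X a), ?_⟩
  conv_rhs => rw [← h.sum_form_smul v]
  simp only [map_sum, map_smul]

theorem sum_quotient (h : IsDualFrame η m e E X Z θ G) (k : Fin n) :
    ∑ l, G k l • dualVec Z G l = Z k := by
  simp only [dualVec, Finset.smul_sum, smul_smul]
  rw [Finset.sum_comm]
  simp only [← Finset.sum_smul, ← Matrix.mul_apply, Matrix.mul_nonsing_inv _ h.isUnit_det]
  simp [Matrix.one_apply]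

/-- The three-tensor of the dual multiplication. -/
theorem sum_sum_eq (i j k : Fin n) :
    ∑ a, ∑ b, G⁻¹ i a * G⁻¹ j b * η (m (Z a) (Z b)) (X k) =
      η (m (dualVec Z G i) (dualVec Z G j)) (X k) := by
  simp only [dualVec, map_sum, map_smul, LinearMap.sum_apply, LinearMap.smul_apply, smul_eq_mul,
    Finset.mul_sum]
  rw [Finset.sum_comm]
  exact Finset.sum_congr rfl fun _ _ => Finset.sum_congr rfl fun _ _ => by ring

theorem mul_injective (h : IsDualFrame η m e E X Z θ G) {u v : T} (huv : m E u = m E v) :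
    u = v := by
  refine sub_eq_zero.mp (h.nondeg _ fun z => ?_)
  have : m E (u - v) = 0 := by rw [map_sub, huv, sub_self]
  rw [h.inv, h.comm z, ← h.inv, h.comm _ E, this]
  simp

end IsDualFrame

/-- `<X i · X j, X k> / E²`. -/
def dualTensor {𝕜 T : Type*} [Field 𝕜] [AddCommGroup T] [Module 𝕜 T] {n : ℕ}
    (η : LinearMap.BilinForm 𝕜 T) (m : T →ₗ[𝕜] T →ₗ[𝕜] T)
    (X Z : Fin n → T) (G : Matrix (Fin n) (Fin n) 𝕜) (i j k : Fin n) : 𝕜 :=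
  η (m (dualVec Z G i) (dualVec Z G j)) (X k)

namespace IsDualFrame

variable {𝕜 T : Type*} [Field 𝕜] [AddCommGroup T] [Module 𝕜 T] {n : ℕ}
    {η : LinearMap.BilinForm 𝕜 T} {m : T →ₗ[𝕜] T →ₗ[𝕜] T} {e E : T}
    {X Z : Fin n → T} {θ : Fin n → Module.Dual 𝕜 T} {G : Matrix (Fin n) (Fin n) 𝕜}

theorem dualTensor_swap₁₂ (h : IsDualFrame η m e E X Z θ G) (i j k : Fin n) :
    dualTensor η m X Z G i j k = dualTensor η m X Z G j i k := by
  rw [dualTensor, dualTensor, h.comm]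

/-- Replacing each `X` by `E` times its quotient gives `E` times a product of three quotients, in
which all indices play the same role. -/
theorem dualTensor_swap₂₃ (h : IsDualFrame η m e E X Z θ G) (i j k : Fin n) :
    dualTensor η m X Z G i j k = dualTensor η m X Z G i k j := by
  rw [dualTensor, dualTensor, ← h.mul_quotient k, ← h.mul_quotient j, h.form_eq,
    h.form_eq (m _ _)]
  congr 1
  simp only [h.assoc, h.comm, h.left_comm]

/-- Here `u` stands for the dual product `X i * X j`, characterised by `E · u = X i · X j` to avoid
an explicit inverse. -/
theorem sum_mul_dualTensor (h : IsDualFrame η m e E X Z θ G) (i j k : Fin n) (u : T)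
    (hu : m E u = m (X i) (X j)) :
    ∑ l, G k l * dualTensor η m X Z G l i j = θ k u := by
  have hterm : ∀ l, dualTensor η m X Z G l i j = η (dualVec Z G l) u := by
    intro l
    have : u = m (dualVec Z G i) (X j) := by
      apply h.mul_injective
      rw [hu, ← h.assoc, h.mul_quotient]
    rw [dualTensor, h.inv, this]
  simp only [hterm]
  rw [← h.sharp, ← h.sum_quotient k]
  simp only [map_sum, map_smul, LinearMap.sum_apply, LinearMap.smul_apply, smul_eq_mul]

/-- Both sides equal `<e, X i · X j · X k · X l / E³>`, which is symmetric in the four indices. -/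
theorem dualTensor_wdvv (h : IsDualFrame η m e E X Z θ G) (i j k l : Fin n) :
    ∑ a, ∑ b, dualTensor η m X Z G i j a * G a b * dualTensor η m X Z G b k l =
      ∑ a, ∑ b, dualTensor η m X Z G l j a * G a b * dualTensor η m X Z G b k i := by
  have key : ∀ i j k l, ∑ a, ∑ b, dualTensor η m X Z G i j a * G a b *
      dualTensor η m X Z G b k l = η e (m (m (dualVec Z G i) (dualVec Z G j))
        (m E (m (dualVec Z G k) (dualVec Z G l)))) := by
    intro i j k l
    have hu : m E (m E (m (dualVec Z G k) (dualVec Z G l))) = m (X k) (X l) := by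
      rw [← h.mul_quotient k, ← h.mul_quotient l]
      simp only [h.assoc, h.left_comm]
    simp only [mul_assoc, ← Finset.mul_sum, h.sum_mul_dualTensor k l _ _ hu]
    rw [← h.form_eq]
    conv_rhs => rw [← h.expand (m E (m (dualVec Z G k) (dualVec Z G l)))]
    simp only [map_sum, map_smul, smul_eq_mul, dualTensor]
    exact Finset.sum_congr rfl fun a _ => mul_comm _ _
  rw [key, key]
  congr 1
  simp only [h.assoc, h.comm, h.left_comm]

/-- `E` is the unity of the dual product: `∑ θ i E • (X i / E) = E / E = e`, leaving `<X j / E, X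
k>`, an entry of `G⁻¹`. -/
theorem sum_euler_mul_dualTensor (h : IsDualFrame η m e E X Z θ G) (j k : Fin n) :
    ∑ i, θ i E * dualTensor η m X Z G i j k = G⁻¹ j k := by
  have hE : ∑ i, θ i E • dualVec Z G i = e := by
    apply h.mul_injective
    simp only [map_sum (m E), map_smul, h.mul_quotient]
    rw [h.expand, h.comm, h.unit]
  have : ∑ i, θ i E * dualTensor η m X Z G i j k =
      η (m (∑ i, θ i E • dualVec Z G i) (dualVec Z G j)) (X k) := by
    simp only [dualTensor, map_sum, map_smul, LinearMap.sum_apply, LinearMap.smul_apply,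
      smul_eq_mul]
  rw [this, hE, h.unit]
  simp [dualVec, map_sum, h.sharp, h.dual]

end IsDualFrame

end Algebra

theorem contDiffOn_smul_const {𝕜 W F : Type*} [RCLike 𝕜] [NormedAddCommGroup W]
    [NormedSpace 𝕜 W] [NormedAddCommGroup F] [NormedSpace 𝕜 F] {f : W → 𝕜} {s : Set W}
    (hf : ContDiffOn 𝕜 ∞ f s) (c : F) : ContDiffOn 𝕜 ∞ (fun y => f y • c) s :=
  hf.smul contDiffOn_const

/-! ### Tangent vectors in charts and changes of coordinates -/

section ChartLemmas

variable {𝕜 : Type*} [RCLike 𝕜] {n : ℕ} {M : Type*} [TopologicalSpace M]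
  [ChartedSpace (Fin n → 𝕜) M]
  {φ ψ : OpenPartialHomeomorph M (Fin n → 𝕜)}

theorem IsCoord.mdifferentiable (hφ : IsCoord φ) :
    φ.MDifferentiable 𝓘(𝕜, Fin n → 𝕜) 𝓘(𝕜, Fin n → 𝕜) :=
  ⟨(contMDiffOn_of_mem_maximalAtlas hφ).mdifferentiableOn (by simp),
    (contMDiffOn_symm_of_mem_maximalAtlas hφ).mdifferentiableOn (by simp)⟩

theorem components_vec (hφ : IsCoord φ) {y : Fin n → 𝕜} (hy : y ∈ φ.target) (u : Fin n → 𝕜) :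
    components φ (φ.symm y) (vec φ y u) = u :=
  DFunLike.congr_fun (hφ.mdifferentiable.comp_symm_deriv hy) u

theorem vec_components (hφ : IsCoord φ) {y : Fin n → 𝕜} (hy : y ∈ φ.target)
    (v : Tan 𝕜 n (φ.symm y)) : vec φ y (components φ (φ.symm y) v) = v := by
  have h := DFunLike.congr_fun (hφ.mdifferentiable.symm_comp_deriv (φ.map_target hy)) v
  rw [φ.right_inv hy] at h
  exact h

theorem vec_add (y u v : Fin n → 𝕜) : vec φ y (u + v) = vec φ y u + vec φ y v :=
  map_add (mfderiv 𝓘(𝕜, Fin n → 𝕜) 𝓘(𝕜, Fin n → 𝕜) φ.symm y) u v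

theorem vec_smul (y : Fin n → 𝕜) (c : 𝕜) (u : Fin n → 𝕜) : vec φ y (c • u) = c • vec φ y u :=
  map_smul (mfderiv 𝓘(𝕜, Fin n → 𝕜) 𝓘(𝕜, Fin n → 𝕜) φ.symm y) c u

/-- `vec` as a linear map. -/
def vecₗ (φ : OpenPartialHomeomorph M (Fin n → 𝕜)) (y : Fin n → 𝕜) :
    (Fin n → 𝕜) →ₗ[𝕜] Tan 𝕜 n (φ.symm y) where
  toFun := vec φ y
  map_add' := vec_add y
  map_smul' := vec_smul y

theorem contDiffOn_transition (hφ : IsCoord φ) (hψ : IsCoord ψ) :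
    ContDiffOn 𝕜 ∞ (fun z => ψ (φ.symm z)) (φ.target ∩ φ.symm ⁻¹' ψ.source) := by
  rw [← contMDiffOn_iff_contDiffOn]
  exact (contMDiffOn_of_mem_maximalAtlas hψ).comp
    ((contMDiffOn_symm_of_mem_maximalAtlas hφ).mono Set.inter_subset_left) (fun z hz => hz.2)

theorem isOpen_transition_source {X Y : Type*} [TopologicalSpace X] [TopologicalSpace Y]
    {φ ψ : OpenPartialHomeomorph X Y} :
    IsOpen (φ.target ∩ φ.symm ⁻¹' ψ.source) :=
  φ.symm.isOpen_inter_preimage ψ.open_source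

theorem differentiableAt_transition (hφ : IsCoord φ) (hψ : IsCoord ψ) {y : Fin n → 𝕜}
    (hy : y ∈ φ.target) (hy' : φ.symm y ∈ ψ.source) :
    DifferentiableAt 𝕜 (fun z => ψ (φ.symm z)) y :=
  ((contDiffOn_transition hφ hψ).differentiableOn (by simp)).differentiableAt
    (isOpen_transition_source.mem_nhds ⟨hy, hy'⟩)

theorem components_vec_of_mem (hφ : IsCoord φ) (hψ : IsCoord ψ) {y : Fin n → 𝕜}
    (hy : y ∈ φ.target) (hy' : φ.symm y ∈ ψ.source) (u : Fin n → 𝕜) :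
    components ψ (φ.symm y) (vec φ y u) = fderiv 𝕜 (fun z => ψ (φ.symm z)) y u := by
  have h := mfderiv_comp y (hψ.mdifferentiable.mdifferentiableAt hy')
    (hφ.mdifferentiable.mdifferentiableAt_symm hy)
  rw [mfderiv_eq_fderiv] at h
  exact (DFunLike.congr_fun h u).symm

theorem jac_eq (hφ : IsCoord φ) (hψ : IsCoord ψ) {y : Fin n → 𝕜}
    (hy : y ∈ φ.target) (hy' : φ.symm y ∈ ψ.source) (a α : Fin n) :
    jac ψ φ a α y = fderiv 𝕜 (fun z => ψ (φ.symm z)) y (Pi.single α 1) a := by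
  rw [jac, pd]
  have := (hasFDerivAt_pi'.mp (differentiableAt_transition hφ hψ hy hy').hasFDerivAt) a
  rw [this.fderiv]
  rfl

end ChartLemmas

/-! ### The Frobenius structure as maps on the coordinate space -/

section Components

variable {𝕜 : Type*} [RCLike 𝕜] {n : ℕ} {M : Type*} [TopologicalSpace M]
  [ChartedSpace (Fin n → 𝕜) M]

namespace FrobeniusField

variable (S : FrobeniusField 𝕜 n M)

/-- The product in the coordinates `φ` as a continuous bilinear map. -/
def mulL (φ : OpenPartialHomeomorph M (Fin n → 𝕜)) (y : Fin n → 𝕜) :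
    (Fin n → 𝕜) →L[𝕜] (Fin n → 𝕜) →L[𝕜] (Fin n → 𝕜) :=
  ∑ α, ∑ β, ∑ γ, S.structConst φ α β γ y •
    (ContinuousLinearMap.proj α : (Fin n → 𝕜) →L[𝕜] 𝕜).smulRight
      ((ContinuousLinearMap.proj β : (Fin n → 𝕜) →L[𝕜] 𝕜).smulRight
        (Pi.single γ 1 : Fin n → 𝕜))

/-- The metric in the coordinates `φ` as a continuous bilinear map. -/
def metricL (φ : OpenPartialHomeomorph M (Fin n → 𝕜)) (y : Fin n → 𝕜) :
    (Fin n → 𝕜) →L[𝕜] (Fin n → 𝕜) →L[𝕜] 𝕜 :=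
  ∑ α, ∑ β, S.gram φ y α β •
    (ContinuousLinearMap.proj α : (Fin n → 𝕜) →L[𝕜] 𝕜).smulRight
      (ContinuousLinearMap.proj β : (Fin n → 𝕜) →L[𝕜] 𝕜)

variable {φ : OpenPartialHomeomorph M (Fin n → 𝕜)}

theorem mulL_apply_apply (y u v : Fin n → 𝕜) (γ : Fin n) :
    S.mulL φ y u v γ = ∑ α, ∑ β, S.structConst φ α β γ y * (u α * v β) := by
  simp [mulL, Finset.sum_apply, Pi.single_apply]

theorem metricL_apply_apply (y u v : Fin n → 𝕜) :
    S.metricL φ y u v = ∑ α, ∑ β, S.gram φ y α β * (u α * v β) := by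
  simp [metricL]

/-- `mulL` is built from the structure constants, so its smoothness is immediate; this
identification transfers to it the algebraic identities of the tangent spaces. -/
theorem mulL_apply (y u v : Fin n → 𝕜) :
    S.mulL φ y u v = S.coordMul φ y u v := by
  have key : ((S.mulL φ y).toLinearMap₁₂ : (Fin n → 𝕜) →ₗ[𝕜] (Fin n → 𝕜) →ₗ[𝕜] (Fin n → 𝕜)) =
      ((S.mul (φ.symm y)).compl₁₂ (vecₗ φ y) (vecₗ φ y)).compr₂ (components φ (φ.symm y)) := by
    refine (Pi.basisFun 𝕜 (Fin n)).ext fun α => (Pi.basisFun 𝕜 (Fin n)).ext fun β => ?_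
    ext γ
    refine (S.mulL_apply_apply y _ _ γ).trans ?_
    simp [Pi.single_apply]
    rfl
  exact LinearMap.congr_fun₂ key u v

theorem metricL_apply (y u v : Fin n → 𝕜) :
    S.metricL φ y u v = S.coordMetric φ y u v := by
  have key : ((S.metricL φ y).toLinearMap₁₂ : (Fin n → 𝕜) →ₗ[𝕜] (Fin n → 𝕜) →ₗ[𝕜] 𝕜) =
      ((S.metric (φ.symm y)).compl₁₂ (vecₗ φ y) (vecₗ φ y)) := by
    refine (Pi.basisFun 𝕜 (Fin n)).ext fun α => (Pi.basisFun 𝕜 (Fin n)).ext fun β => ?_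
    refine (S.metricL_apply_apply y _ _).trans ?_
    simp [Pi.single_apply]
    rfl
  exact LinearMap.congr_fun₂ key u v

theorem contDiffOn_mulL {d : 𝕜} (hS : S.IsFrobeniusManifold d) (hφ : IsCoord φ) :
    ContDiffOn 𝕜 ∞ (S.mulL φ) φ.target :=
  ContDiffOn.sum fun α _ => ContDiffOn.sum fun β _ => ContDiffOn.sum fun γ _ =>
    contDiffOn_smul_const (hS.smooth_mul φ hφ α β γ) _

theorem christoffel_eq_zero {g : (Fin n → 𝕜) → Matrix (Fin n) (Fin n) 𝕜}
    {V : Set (Fin n → 𝕜)} (hV : IsOpen V) {η : Matrix (Fin n) (Fin n) 𝕜}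
    (hg : ∀ y ∈ V, g y = η) {y : Fin n → 𝕜} (hy : y ∈ V) (γ α β : Fin n) :
    christoffel g γ α β y = 0 := by
  have h : ∀ i j k, pd i (fun z => g z j k) y = 0 := fun i j k => by
    rw [pd_congr hV (g := fun _ => η j k) (fun z hz => by simp only [hg z hz]) hy]
    simp [pd]
  simp [christoffel, h]

section

variable {y : Fin n → 𝕜}

/-- Stated at a point `x` of the manifold, so that it applies to points presented through another
chart. -/
theorem metric_mul_eq (hφ : IsCoord φ) {x : M} (hx : x ∈ φ.source) (u v w : Tan 𝕜 n x) :
    S.metric x (S.mul x u v) w = S.metricL φ (φ x)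
      (S.mulL φ (φ x) (components φ x u) (components φ x v)) (components φ x w) := by
  obtain ⟨y, hy, rfl⟩ : ∃ y ∈ φ.target, φ.symm y = x := ⟨φ x, φ.map_source hx, φ.left_inv hx⟩
  rw [φ.right_inv hy, metricL_apply, mulL_apply, coordMetric, coordMul]
  simp only [vec_components hφ hy]

theorem metric_eq (hφ : IsCoord φ) {x : M} (hx : x ∈ φ.source) (u v : Tan 𝕜 n x) :
    S.metric x u v = S.metricL φ (φ x) (components φ x u) (components φ x v) := by
  obtain ⟨y, hy, rfl⟩ : ∃ y ∈ φ.target, φ.symm y = x := ⟨φ x, φ.map_source hx, φ.left_inv hx⟩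
  rw [φ.right_inv hy, metricL_apply, coordMetric]
  simp only [vec_components hφ hy]

theorem metricL_symm (u v : Fin n → 𝕜) : S.metricL φ y u v = S.metricL φ y v u := by
  rw [metricL_apply, metricL_apply, coordMetric, coordMetric, S.metric_symm]

theorem mulL_comm (u v : Fin n → 𝕜) : S.mulL φ y u v = S.mulL φ y v u := by
  rw [mulL_apply, mulL_apply, coordMul, coordMul, S.mul_comm]

theorem mulL_assoc (hφ : IsCoord φ) (hy : y ∈ φ.target) (u v w : Fin n → 𝕜) :
    S.mulL φ y (S.mulL φ y u v) w = S.mulL φ y u (S.mulL φ y v w) := by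
  simp only [mulL_apply, coordMul, vec_components hφ hy, S.mul_assoc]

theorem mulL_unit (hφ : IsCoord φ) (hy : y ∈ φ.target) (u : Fin n → 𝕜) :
    S.mulL φ y (S.eComp φ y) u = u := by
  simp only [mulL_apply, coordMul, eComp, vec_components hφ hy, S.e_mul, components_vec hφ hy]

theorem metricL_inv (hφ : IsCoord φ) (hy : y ∈ φ.target) (u v w : Fin n → 𝕜) :
    S.metricL φ y (S.mulL φ y u v) w = S.metricL φ y u (S.mulL φ y v w) := by
  simp only [mulL_apply, metricL_apply, coordMetric, coordMul, vec_components hφ hy, S.invariant]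

theorem metricL_nondeg (hφ : IsCoord φ) (hy : y ∈ φ.target) (z : Fin n → 𝕜)
    (hz : ∀ v, S.metricL φ y z v = 0) : z = 0 := by
  have : vec φ y z = 0 := by
    refine (S.metric_nondegenerate (φ.symm y)).1 _ fun v => ?_
    have := hz (components φ _ v)
    rwa [metricL_apply, coordMetric, vec_components hφ hy] at this
  rw [← components_vec hφ hy z, this, map_zero]

end

end FrobeniusField

end Components

/-! ### Calculus in flat coordinates -/

section FlatCalculus

variable {𝕜 : Type*} [RCLike 𝕜] {W : Type*} [NormedAddCommGroup W] [NormedSpace 𝕜 W]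
  {W' : Type*} [NormedAddCommGroup W'] [NormedSpace 𝕜 W']

theorem minSmoothness_two_le_infty : minSmoothness 𝕜 2 ≤ ∞ := by
  rw [minSmoothness_of_isRCLikeNormedField]
  exact WithTop.coe_le_coe.mpr (le_top : (2 : ℕ∞) ≤ ⊤)

/-- Raising an index by a fixed continuous linear map makes gradients smooth. -/
theorem exists_sharp [FiniteDimensional 𝕜 W] (η : W →L[𝕜] W →L[𝕜] 𝕜)
    (hη : ∀ z, (∀ v, η z v = 0) → z = 0) :
    ∃ sharp : (W →L[𝕜] 𝕜) →L[𝕜] W, ∀ θ v, η (sharp θ) v = θ v := by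
  have hinj : Function.Injective (η : W →ₗ[𝕜] (W →L[𝕜] 𝕜)) := by
    rw [injective_iff_map_eq_zero]
    exact fun z hz => hη z fun v => by simpa using DFunLike.congr_fun hz v
  have hdim : Module.finrank 𝕜 W = Module.finrank 𝕜 (W →L[𝕜] 𝕜) := by
    rw [← (LinearMap.toContinuousLinearMap : (W →ₗ[𝕜] 𝕜) ≃ₗ[𝕜] (W →L[𝕜] 𝕜)).finrank_eq]
    exact Subspace.dual_finrank_eq.symm
  have : FiniteDimensional 𝕜 (W →L[𝕜] 𝕜) :=
    (LinearMap.toContinuousLinearMap : (W →ₗ[𝕜] 𝕜) ≃ₗ[𝕜] (W →L[𝕜] 𝕜)).finiteDimensional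
  let L := LinearMap.linearEquivOfInjective _ hinj hdim
  refine ⟨LinearMap.toContinuousLinearMap L.symm.toLinearMap, fun θ v => ?_⟩
  exact DFunLike.congr_fun (L.apply_symm_apply θ) v

theorem hasFDerivAt_bilin {m : W → W →L[𝕜] W →L[𝕜] W} {X Y : W → W}
    {m' : W →L[𝕜] W →L[𝕜] W →L[𝕜] W} {X' Y' : W →L[𝕜] W} {y : W} (hm : HasFDerivAt m m' y)
    (hX : HasFDerivAt X X' y) (hY : HasFDerivAt Y Y' y) :
    ∃ L : W →L[𝕜] W, HasFDerivAt (fun z => m z (X z) (Y z)) L y ∧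
      ∀ w, L w = m' w (X y) (Y y) + m y (X' w) (Y y) + m y (X y) (Y' w) := by
  refine ⟨_, (hm.clm_apply hX).clm_apply hY, fun w => ?_⟩
  simp
  abel

theorem hasFDerivAt_form (η : W →L[𝕜] W →L[𝕜] 𝕜) {X Y : W' → W}
    {X' Y' : W' →L[𝕜] W} {y : W'} (hX : HasFDerivAt X X' y) (hY : HasFDerivAt Y Y' y) :
    ∃ L : W' →L[𝕜] 𝕜, HasFDerivAt (fun z => η (X z) (Y z)) L y ∧
      ∀ w, L w = η (X' w) (Y y) + η (X y) (Y' w) := by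
  refine ⟨_, (η.hasFDerivAt.comp y hX).clm_apply hY, fun w => ?_⟩
  simp [add_comm]

/-- Since `η (ξ z) = df`, the form `η ∘ Dξ` is the second derivative of `f`. -/
theorem hessian_symm {Ω : Set W} (hΩ : IsOpen Ω) {f : W → 𝕜} (hf : ContDiffOn 𝕜 ∞ f Ω)
    (η : W →L[𝕜] W →L[𝕜] 𝕜) {ξ : W → W} {y : W} (hy : y ∈ Ω) (hξ : DifferentiableAt 𝕜 ξ y)
    (h : ∀ z ∈ Ω, η (ξ z) = fderiv 𝕜 f z) (w v : W) :
    η (fderiv 𝕜 ξ y w) v = η (fderiv 𝕜 ξ y v) w := by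
  have e : fderiv 𝕜 (fderiv 𝕜 f) y = η.comp (fderiv 𝕜 ξ y) := by
    have : fderiv 𝕜 f =ᶠ[nhds y] fun z => η (ξ z) :=
      Filter.eventuallyEq_of_mem (hΩ.mem_nhds hy) fun z hz => (h z hz).symm
    rw [this.fderiv_eq]
    exact (η.hasFDerivAt.comp y hξ.hasFDerivAt).fderiv
  have hs := ((hf.contDiffAt (hΩ.mem_nhds hy)).isSymmSndFDerivAt minSmoothness_two_le_infty) w v
  rw [e] at hs
  exact hs

/-- The pullback of a closed one-form is closed: the additional term contains the second derivative
of `ψ`, which is symmetric. -/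
theorem fderiv_pullback_symm {V : Set W'} (hV : IsOpen V) {ψ : W' → W}
    (hψ : ContDiffOn 𝕜 ∞ ψ V) (η : W →L[𝕜] W →L[𝕜] 𝕜) {X : W → W} {X' : W →L[𝕜] W} {y : W'}
    (hy : y ∈ V) (hX : HasFDerivAt X X' (ψ y)) (hsymm : ∀ w v, η (X' w) v = η (X' v) w)
    (u v : W') :
    fderiv 𝕜 (fun z => η (X (ψ z)) (fderiv 𝕜 ψ z v)) y u =
      fderiv 𝕜 (fun z => η (X (ψ z)) (fderiv 𝕜 ψ z u)) y v := by
  have hψy : HasFDerivAt ψ (fderiv 𝕜 ψ y) y :=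
    ((hψ.differentiableOn (by simp)).differentiableAt (hV.mem_nhds hy)).hasFDerivAt
  have hψ' : HasFDerivAt (fderiv 𝕜 ψ) (fderiv 𝕜 (fderiv 𝕜 ψ) y) y :=
    (((hψ.fderiv_of_isOpen (m := ∞) hV (by simp)).differentiableOn
      (by simp)).differentiableAt (hV.mem_nhds hy)).hasFDerivAt
  have hs := (hψ.contDiffAt (hV.mem_nhds hy)).isSymmSndFDerivAt minSmoothness_two_le_infty
  have key : ∀ u v, fderiv 𝕜 (fun z => η (X (ψ z)) (fderiv 𝕜 ψ z v)) y u =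
      η (X' (fderiv 𝕜 ψ y u)) (fderiv 𝕜 ψ y v) +
        η (X (ψ y)) (fderiv 𝕜 (fderiv 𝕜 ψ) y u v) := by
    intro u v
    obtain ⟨L, hL, hLa⟩ := hasFDerivAt_form η (hX.comp y hψy)
      (hψ'.clm_apply (hasFDerivAt_const v y))
    refine (DFunLike.congr_fun hL.fderiv u).trans ?_
    simp [hLa]
  rw [key, key, hsymm, hs u v]

/-- The structures of a Frobenius manifold of charge `d` in flat coordinates on `Ω`, together with
gradients `ξ a` of functions, orthogonal in the intersection form. -/
structure FlatSystem {ι : Type*} (Ω : Set W) (η : W →L[𝕜] W →L[𝕜] 𝕜)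
    (m : W → W →L[𝕜] W →L[𝕜] W) (E e : W → W) (d : 𝕜) (ξ : ι → W → W) (G : ι → ι → 𝕜) :
    Prop where
  isOpen : IsOpen Ω
  smooth_mul : ContDiffOn 𝕜 ∞ m Ω
  smooth_E : ContDiffOn 𝕜 ∞ E Ω
  smooth_grad : ∀ a, ContDiffOn 𝕜 ∞ (ξ a) Ω
  symm : ∀ u v, η u v = η v u
  comm : ∀ y ∈ Ω, ∀ u v, m y u v = m y v u
  assoc : ∀ y ∈ Ω, ∀ u v w, m y (m y u v) w = m y u (m y v w)
  unit : ∀ y ∈ Ω, ∀ u, m y (e y) u = u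
  inv : ∀ y ∈ Ω, ∀ u v w, η (m y u v) w = η u (m y v w)
  cov : ∀ y ∈ Ω, ∀ u v w, fderiv 𝕜 m y u v w = fderiv 𝕜 m y v u w
  euler : ∀ y ∈ Ω, ∀ u v, fderiv 𝕜 m y (E y) u v - fderiv 𝕜 E y (m y u v)
    + m y (fderiv 𝕜 E y u) v + m y u (fderiv 𝕜 E y v) = m y u v
  conformal : ∀ y ∈ Ω, ∀ u v, η (fderiv 𝕜 E y u) v + η u (fderiv 𝕜 E y v) = (2 - d) * η u v
  hess : ∀ y ∈ Ω, ∀ a w v, η (fderiv 𝕜 (ξ a) y w) v = η (fderiv 𝕜 (ξ a) y v) w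
  gram : ∀ y ∈ Ω, ∀ a b, η (m y (E y) (ξ a y)) (ξ b y) = G a b
  span : ∀ y ∈ Ω, Submodule.span 𝕜 (Set.range fun c => m y (E y) (ξ c y)) = ⊤
  sep : ∀ y ∈ Ω, ∀ z, (∀ b, η z (ξ b y) = 0) → z = 0

namespace FlatSystem

variable {ι : Type*} {Ω : Set W} {η : W →L[𝕜] W →L[𝕜] 𝕜}
    {m : W → W →L[𝕜] W →L[𝕜] W} {E e : W → W} {d : 𝕜} {ξ : ι → W → W} {G : ι → ι → 𝕜} {y : W}

theorem hasFDerivAt_mul (h : FlatSystem Ω η m E e d ξ G) (hy : y ∈ Ω) :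
    HasFDerivAt m (fderiv 𝕜 m y) y :=
  ((h.smooth_mul.differentiableOn (by simp)).differentiableAt (h.isOpen.mem_nhds hy)).hasFDerivAt

theorem hasFDerivAt_E (h : FlatSystem Ω η m E e d ξ G) (hy : y ∈ Ω) :
    HasFDerivAt E (fderiv 𝕜 E y) y :=
  ((h.smooth_E.differentiableOn (by simp)).differentiableAt (h.isOpen.mem_nhds hy)).hasFDerivAt

theorem hasFDerivAt_grad (h : FlatSystem Ω η m E e d ξ G) (hy : y ∈ Ω) (a : ι) :
    HasFDerivAt (ξ a) (fderiv 𝕜 (ξ a) y) y :=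
  (((h.smooth_grad a).differentiableOn (by simp)).differentiableAt
    (h.isOpen.mem_nhds hy)).hasFDerivAt

theorem flatJet (h : FlatSystem Ω η m E e d ξ G) (hy : y ∈ Ω) :
    FlatJet η (m y) (fderiv 𝕜 m y) (fderiv 𝕜 E y) (E y) (e y) d (fun a => ξ a y)
      (fun a => fderiv 𝕜 (ξ a) y) where
  symm := h.symm
  comm := h.comm y hy
  assoc := h.assoc y hy
  unit := h.unit y hy
  inv := h.inv y hy
  cov₁₂ w u v z := by rw [h.cov y hy]
  -- Only one transposition is assumed in `cov`; the others come from differentiating invariance and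
  -- commutativity of the product.
  cov₁₄ w u v z := by
    have hinv : ∀ u v w z, η (fderiv 𝕜 m y u v w) z = η v (fderiv 𝕜 m y u w z) := by
      intro u v w z
      obtain ⟨L₁, hL₁, hL₁a⟩ := hasFDerivAt_bilin (h.hasFDerivAt_mul hy)
        (hasFDerivAt_const v y) (hasFDerivAt_const w y)
      obtain ⟨L₂, hL₂, hL₂a⟩ := hasFDerivAt_bilin (h.hasFDerivAt_mul hy)
        (hasFDerivAt_const w y) (hasFDerivAt_const z y)
      obtain ⟨K₁, hK₁, hK₁a⟩ := hasFDerivAt_form η hL₁ (hasFDerivAt_const z y)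
      obtain ⟨K₂, hK₂, hK₂a⟩ := hasFDerivAt_form η (hasFDerivAt_const v y) hL₂
      have he : (fun x => η (m x v w) z) =ᶠ[nhds y] fun x => η v (m x w z) :=
        Filter.eventuallyEq_of_mem (h.isOpen.mem_nhds hy) fun x hx => h.inv x hx v w z
      have := DFunLike.congr_fun ((hK₁.congr_of_eventuallyEq he.symm).unique hK₂) u
      simpa [hK₁a, hK₂a, hL₁a, hL₂a] using this
    have hcomm : ∀ u v w, fderiv 𝕜 m y u v w = fderiv 𝕜 m y u w v := by
      intro u v w
      obtain ⟨L₁, hL₁, hL₁a⟩ := hasFDerivAt_bilin (h.hasFDerivAt_mul hy)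
        (hasFDerivAt_const v y) (hasFDerivAt_const w y)
      obtain ⟨L₂, hL₂, hL₂a⟩ := hasFDerivAt_bilin (h.hasFDerivAt_mul hy)
        (hasFDerivAt_const w y) (hasFDerivAt_const v y)
      have he : (fun x => m x v w) =ᶠ[nhds y] fun x => m x w v :=
        Filter.eventuallyEq_of_mem (h.isOpen.mem_nhds hy) fun x hx => h.comm x hx v w
      have := DFunLike.congr_fun ((hL₁.congr_of_eventuallyEq he.symm).unique hL₂) u
      simpa [hL₁a, hL₂a] using this
    rw [h.cov y hy, hinv, h.symm, hcomm, h.cov y hy]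
  euler := h.euler y hy
  conformal := h.conformal y hy
  hess := h.hess y hy
  compat a b w := by
    obtain ⟨L, hL, hLa⟩ := hasFDerivAt_bilin (h.hasFDerivAt_mul hy) (h.hasFDerivAt_E hy)
      (h.hasFDerivAt_grad hy a)
    obtain ⟨K, hK, hKa⟩ := hasFDerivAt_form η hL (h.hasFDerivAt_grad hy b)
    have he : (fun x => η (m x (E x) (ξ a x)) (ξ b x)) =ᶠ[nhds y] fun _ => G a b :=
      Filter.eventuallyEq_of_mem (h.isOpen.mem_nhds hy) fun x hx => h.gram x hx a b
    have := DFunLike.congr_fun ((hK.congr_of_eventuallyEq he.symm).unique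
      (hasFDerivAt_const _ y)) w
    simp only [hKa, hLa, map_add, add_apply] at this
    refine Eq.trans ?_ this
    ring
  span := h.span y hy
  sep := h.sep y hy

theorem fderiv_pullback_symm (h : FlatSystem Ω η m E e d ξ G) {V : Set W'} (hV : IsOpen V)
    {ψ : W' → W} (hψ : ContDiffOn 𝕜 ∞ ψ V) (hmaps : Set.MapsTo ψ V Ω) (a b : ι) {y : W'}
    (hy : y ∈ V) (u v : W') :
    fderiv 𝕜 (fun z => η (m (ψ z) (ξ a (ψ z)) (ξ b (ψ z))) (fderiv 𝕜 ψ z v)) y u =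
      fderiv 𝕜 (fun z => η (m (ψ z) (ξ a (ψ z)) (ξ b (ψ z))) (fderiv 𝕜 ψ z u)) y v := by
  have hτ := hmaps hy
  obtain ⟨L, hL, hLa⟩ := hasFDerivAt_bilin (h.hasFDerivAt_mul hτ) (h.hasFDerivAt_grad hτ a)
    (h.hasFDerivAt_grad hτ b)
  refine AlmostDuality.fderiv_pullback_symm hV hψ η hy hL (fun w v => ?_) u v
  rw [hLa, hLa]
  exact (h.flatJet hτ).closed a b w v

theorem contDiffOn_pullback (h : FlatSystem Ω η m E e d ξ G) {V : Set W'} (hV : IsOpen V)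
    {ψ : W' → W} (hψ : ContDiffOn 𝕜 ∞ ψ V) (hmaps : Set.MapsTo ψ V Ω) (a b : ι) (v : W') :
    ContDiffOn 𝕜 ∞ (fun z => η (m (ψ z) (ξ a (ψ z)) (ξ b (ψ z))) (fderiv 𝕜 ψ z v)) V := by
  have h1 := h.smooth_mul.comp hψ hmaps
  have h2 := (h.smooth_grad a).comp hψ hmaps
  have h3 := (h.smooth_grad b).comp hψ hmaps
  have h4 : ContDiffOn 𝕜 ∞ (fun z => fderiv 𝕜 ψ z v) V :=
    (hψ.fderiv_of_isOpen (m := ∞) hV (by simp)).clm_apply contDiffOn_const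
  exact (η.contDiff.comp_contDiffOn ((h1.clm_apply h2).clm_apply h3)).clm_apply h4

/-- The pairing `η (ξ a) E` is the function `E(p^a)`; this derivative will show that it is affine in
`p`. -/
theorem hasFDerivAt_euler (h : FlatSystem Ω η m E e d ξ G) {ψ : W' → W}
    {y : W'} (hψ : DifferentiableAt 𝕜 ψ y) (hy : ψ y ∈ Ω) (a : ι) :
    ∃ L : W' →L[𝕜] 𝕜, HasFDerivAt (fun z => η (ξ a (ψ z)) (E (ψ z))) L y ∧
      ∀ w, L w = (1 - d) / 2 * η (ξ a (ψ y)) (fderiv 𝕜 ψ y w) := by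
  obtain ⟨L, hL, hLa⟩ := hasFDerivAt_form η ((h.hasFDerivAt_grad hy a).comp y hψ.hasFDerivAt)
    ((h.hasFDerivAt_E hy).comp y hψ.hasFDerivAt)
  exact ⟨L, hL, fun w => (hLa w).trans ((h.flatJet hy).euler_gradient a _)⟩

end FlatSystem

end FlatCalculus

theorem clm_pi_ext {𝕜 F : Type*} [RCLike 𝕜] {n : ℕ} [NormedAddCommGroup F] [NormedSpace 𝕜 F]
    {f g : (Fin n → 𝕜) →L[𝕜] F} (h : ∀ α, f (Pi.single α 1) = g (Pi.single α 1)) : f = g := by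
  refine ContinuousLinearMap.coe_injective ((Pi.basisFun 𝕜 (Fin n)).ext fun α => ?_)
  simpa using h α

theorem clm_pi_swap {𝕜 F : Type*} [RCLike 𝕜] {n : ℕ} [NormedAddCommGroup F] [NormedSpace 𝕜 F]
    {f : (Fin n → 𝕜) →L[𝕜] (Fin n → 𝕜) →L[𝕜] F}
    (h : ∀ α β, f (Pi.single α 1) (Pi.single β 1) = f (Pi.single β 1) (Pi.single α 1))
    (u v : Fin n → 𝕜) : f u v = f v u := by
  have : f = f.flip := clm_pi_ext fun α => clm_pi_ext fun β => h α β
  exact congrArg (fun g => g u v) this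

namespace FrobeniusField

variable {𝕜 : Type*} [RCLike 𝕜] {n : ℕ} {M : Type*} [TopologicalSpace M]
  [ChartedSpace (Fin n → 𝕜) M] (S : FrobeniusField 𝕜 n M)

/-! ### The coordinate frame of `p` as a dual frame -/

section DualFrame

variable {p : OpenPartialHomeomorph M (Fin n → 𝕜)} {G : Matrix (Fin n) (Fin n) 𝕜}

theorem interForm_eq (x : M) (θ₁ θ₂ : Module.Dual 𝕜 (Tan 𝕜 n x)) :
    S.interForm x θ₁ θ₂ =
      S.metric x (S.mul x ((S.flat x).symm θ₁) ((S.flat x).symm θ₂)) (S.E x) := rfl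

theorem metric_flat_symm (x : M) (θ : Module.Dual 𝕜 (Tan 𝕜 n x)) (v : Tan 𝕜 n x) :
    S.metric x ((S.flat x).symm θ) v = θ v :=
  LinearMap.BilinForm.apply_toDual_symm_apply _ _

theorem isDualFrame (hp : S.IsInterFlatCoord p G) {y : Fin n → 𝕜} (hy : y ∈ p.target) :
    IsDualFrame (S.metric (p.symm y)) (S.mul (p.symm y)) (S.e (p.symm y)) (S.E (p.symm y))
      (fun i => frame p i y) (fun a => (S.flat (p.symm y)).symm (dcoord p a (p.symm y)))
      (fun a => dcoord p a (p.symm y)) G where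
  symm := S.metric_symm _
  comm := S.mul_comm _
  assoc := S.mul_assoc _
  unit := S.e_mul _
  inv := S.invariant _
  expand v := by
    conv_rhs => rw [← vec_components hp.1 hy v]
    change ∑ a, components p (p.symm y) v a • vecₗ p y (Pi.single a 1) =
      vecₗ p y (components p (p.symm y) v)
    conv_rhs => rw [pi_eq_sum_univ' (components p (p.symm y) v)]
    simp only [map_sum, map_smul]
  dual a b := by
    change components p (p.symm y) (vec p y (Pi.single b 1)) a = _
    rw [components_vec hp.1 hy]
    simp [Pi.single_apply]
  sharp a v := S.metric_flat_symm _ _ _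
  nondeg z hz := by
    -- A nonzero kernel vector, turned into a covector by the metric, would place the point on the
    -- discriminant.
    by_contra hne
    refine hp.2.1 (p.map_target hy) ⟨S.flat _ z, by simpa using hne, fun θ' => ?_⟩
    rw [interForm_eq, LinearEquiv.symm_apply_apply]
    exact hz _
  gram a b := hp.2.2 _ (p.map_target hy) a b

theorem mul_euler_star (hp : S.IsInterFlatCoord p G) {y : Fin n → 𝕜} (hy : y ∈ p.target)
    (u v : Tan 𝕜 n (p.symm y)) :
    S.mul (p.symm y) (S.E (p.symm y)) (S.star (p.symm y) u v) = S.mul (p.symm y) u v := by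
  -- `Ring.inverse` is zero on non-units, so invertibility must be known; injectivity suffices in
  -- finite dimension.
  have hu : IsUnit (S.mul (p.symm y) (S.E (p.symm y)) : Module.End 𝕜 (Tan 𝕜 n (p.symm y))) := by
    rw [LinearMap.isUnit_iff_ker_eq_bot, LinearMap.ker_eq_bot]
    exact fun a b hab => (S.isDualFrame hp hy).mul_injective hab
  exact LinearMap.congr_fun (Ring.mul_inverse_cancel _ hu) _

end DualFrame

/-! ### The axioms of a Frobenius manifold in flat coordinates -/

section Flat

variable {t p : OpenPartialHomeomorph M (Fin n → 𝕜)} {G : Matrix (Fin n) (Fin n) 𝕜} {d : 𝕜}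

theorem lieBracket_const {E : (Fin n → 𝕜) → (Fin n → 𝕜)} (y u : Fin n → 𝕜) :
    VectorField.lieBracket 𝕜 E (fun _ => u) y = - fderiv 𝕜 E y u := by
  simp [VectorField.lieBracket]

theorem metricL_eq (ht : S.IsFlatCoord t) {y z : Fin n → 𝕜} (hy : y ∈ t.target)
    (hz : z ∈ t.target) : S.metricL t y = S.metricL t z := by
  obtain ⟨-, η, hη⟩ := ht
  rw [metricL, metricL, hη y hy, hη z hz]

/-- With a constant Gram matrix the Christoffel coefficients vanish, so `symm_cov` concerns partial
derivatives; nondegeneracy of the metric removes the last argument. -/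
theorem fderiv_mulL_symm (hS : S.IsFrobeniusManifold d) (ht : S.IsFlatCoord t)
    {y : Fin n → 𝕜} (hy : y ∈ t.target) (u v w : Fin n → 𝕜) :
    fderiv 𝕜 (S.mulL t) y u v w = fderiv 𝕜 (S.mulL t) y v u w := by
  have hm : HasFDerivAt (S.mulL t) (fderiv 𝕜 (S.mulL t) y) y :=
    (((S.contDiffOn_mulL hS ht.1).differentiableOn (by simp)).differentiableAt
      (t.open_target.mem_nhds hy)).hasFDerivAt
  have hthree : ∀ α β γ, ∀ z ∈ t.target, S.threeTensor t α β γ z =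
      S.metricL t y (S.mulL t z (Pi.single α 1) (Pi.single β 1)) (Pi.single γ 1) := by
    intro α β γ z hz
    rw [S.metricL_eq ht hy hz, mulL_apply, metricL_apply, coordMetric, coordMul,
      vec_components ht.1 hz]
    rfl
  have hpd : ∀ δ α β γ, pd δ (S.threeTensor t α β γ) y =
      S.metricL t y (fderiv 𝕜 (S.mulL t) y (Pi.single δ 1) (Pi.single α 1) (Pi.single β 1))
        (Pi.single γ 1) := by
    intro δ α β γ
    rw [pd_congr t.open_target (hthree α β γ) hy]
    obtain ⟨L, hL, hLa⟩ := hasFDerivAt_bilin hm (hasFDerivAt_const (Pi.single α 1) y)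
      (hasFDerivAt_const (Pi.single β 1) y)
    obtain ⟨K, hK, hKa⟩ := hasFDerivAt_form (S.metricL t y) hL
      (hasFDerivAt_const (Pi.single γ 1) y)
    rw [pd_eq_of_hasFDerivAt hK, hKa, hLa]
    simp
  obtain ⟨η, hη⟩ := ht.2
  have hcov : ∀ δ α β γ, covThree (S.gram t) (S.threeTensor t) δ α β γ y =
      pd δ (S.threeTensor t α β γ) y := by
    intro δ α β γ
    simp [covThree, christoffel_eq_zero t.open_target hη hy]
  have hbasis : ∀ δ α β, fderiv 𝕜 (S.mulL t) y (Pi.single δ 1) (Pi.single α 1) (Pi.single β 1) =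
      fderiv 𝕜 (S.mulL t) y (Pi.single α 1) (Pi.single δ 1) (Pi.single β 1) := by
    intro δ α β
    refine sub_eq_zero.mp (S.metricL_nondeg ht.1 hy _ fun v => ?_)
    rw [pi_eq_sum_univ' v]
    simp only [map_sum, map_smul, map_sub, sub_apply]
    refine Finset.sum_eq_zero fun γ _ => ?_
    have := (hS.symm_cov t ht.1 y hy δ α β γ).1
    rw [hcov, hcov, hpd, hpd] at this
    rw [this, sub_self, smul_zero]
  have h := clm_pi_swap (f := fderiv 𝕜 (S.mulL t) y)
    (fun α β => clm_pi_ext fun γ => hbasis α β γ) u v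
  rw [h]

/-- The axiom is applied to constant fields, for which `[E, u] = -DE(u)`. -/
theorem fderiv_mulL_euler (hS : S.IsFrobeniusManifold d) (ht : S.IsFlatCoord t)
    {y : Fin n → 𝕜} (hy : y ∈ t.target) (u v : Fin n → 𝕜) :
    fderiv 𝕜 (S.mulL t) y (S.EComp t y) u v - fderiv 𝕜 (S.EComp t) y (S.mulL t y u v)
      + S.mulL t y (fderiv 𝕜 (S.EComp t) y u) v + S.mulL t y u (fderiv 𝕜 (S.EComp t) y v) =
      S.mulL t y u v := by
  have hm : HasFDerivAt (S.mulL t) (fderiv 𝕜 (S.mulL t) y) y :=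
    (((S.contDiffOn_mulL hS ht.1).differentiableOn (by simp)).differentiableAt
      (t.open_target.mem_nhds hy)).hasFDerivAt
  have h := hS.euler_mul t ht.1 (fun _ => u) (fun _ => v) contDiffOn_const contDiffOn_const y hy
  simp only [← mulL_apply, lieBracket_const] at h
  rw [VectorField.lieBracket] at h
  obtain ⟨L, hL, hLa⟩ := hasFDerivAt_bilin hm (hasFDerivAt_const u y) (hasFDerivAt_const v y)
  rw [hL.fderiv, hLa] at h
  simpa using h

theorem metricL_euler (hS : S.IsFrobeniusManifold d) (ht : S.IsFlatCoord t)
    {y : Fin n → 𝕜} (hy : y ∈ t.target) (u v : Fin n → 𝕜) :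
    S.metricL t y (fderiv 𝕜 (S.EComp t) y u) v + S.metricL t y u (fderiv 𝕜 (S.EComp t) y v) =
      (2 - d) * S.metricL t y u v := by
  have h := hS.euler_metric t ht.1 (fun _ => u) (fun _ => v) contDiffOn_const contDiffOn_const
    y hy
  simp only [← metricL_apply, lieBracket_const] at h
  have he : (fun z => S.metricL t z u v) =ᶠ[nhds y] fun _ => S.metricL t y u v :=
    Filter.eventuallyEq_of_mem (t.open_target.mem_nhds hy) fun z hz => by
      simp only [S.metricL_eq ht hz hy]
  rw [he.fderiv_eq] at h
  simpa using h

/-- The components of the gradient of the coordinate `p^a` for the form `η`. -/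
theorem components_flat_symm (ht : S.IsFlatCoord t) (hp : IsCoord p) {x : M}
    (hxt : x ∈ t.source) (hxp : x ∈ p.source) (a : Fin n) {ζ : Fin n → 𝕜}
    (hζ : ∀ v, S.metricL t (t x) ζ v = fderiv 𝕜 (fun z => p (t.symm z)) (t x) v a) :
    components t x ((S.flat x).symm (dcoord p a x)) = ζ := by
  have hinj := S.metricL_nondeg ht.1 (t.map_source hxt)
  refine sub_eq_zero.mp (hinj _ fun v => ?_)
  rw [map_sub, sub_apply, hζ, sub_eq_zero]
  obtain ⟨y, hy, rfl⟩ : ∃ y ∈ t.target, t.symm y = x := ⟨t x, t.map_source hxt, t.left_inv hxt⟩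
  have h := S.metric_eq ht.1 hxt ((S.flat (t.symm y)).symm (dcoord p a (t.symm y))) (vec t y v)
  rw [components_vec ht.1 hy] at h
  rw [← h, metric_flat_symm, t.right_inv hy, ← components_vec_of_mem ht.1 hp hy hxp]
  rfl

/-- The gradients of the flat coordinates `p` of the intersection form, in the flat
coordinates `t` of the metric. -/
theorem exists_flatSystem (hS : S.IsFrobeniusManifold d) (ht : S.IsFlatCoord t)
    (hp : S.IsInterFlatCoord p G) {y₀ : Fin n → 𝕜} (hy₀ : y₀ ∈ t.target) :
    ∃ ξ : Fin n → (Fin n → 𝕜) → (Fin n → 𝕜),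
      FlatSystem (t.target ∩ t.symm ⁻¹' p.source) (S.metricL t y₀) (S.mulL t) (S.EComp t)
        (S.eComp t) d ξ (fun a b => G a b) ∧
      (∀ a, ∀ y ∈ t.target ∩ t.symm ⁻¹' p.source, ∀ v, S.metricL t y₀ (ξ a y) v =
        fderiv 𝕜 (fun z => p (t.symm z)) y v a) := by
  -- The metric is frozen at `y₀`; being constant in these coordinates it serves at every point.
  obtain ⟨sharp, hsharp⟩ := exists_sharp (S.metricL t y₀) (S.metricL_nondeg ht.1 hy₀)
  have hΩ : IsOpen (t.target ∩ t.symm ⁻¹' p.source) := isOpen_transition_source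
  have hpt := contDiffOn_transition ht.1 hp.1
  have hpta : ∀ a, ContDiffOn 𝕜 ∞ (fun z => p (t.symm z) a) (t.target ∩ t.symm ⁻¹' p.source) :=
    fun a => contDiffOn_pi.mp hpt a
  set ξ : Fin n → (Fin n → 𝕜) → (Fin n → 𝕜) := fun a y =>
    sharp (fderiv 𝕜 (fun z => p (t.symm z) a) y) with hξ
  have hξC : ∀ a, ContDiffOn 𝕜 ∞ (ξ a) (t.target ∩ t.symm ⁻¹' p.source) := fun a =>
    sharp.contDiff.comp_contDiffOn ((hpta a).fderiv_of_isOpen (m := ∞) hΩ (by simp))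
  have hξ₀ : ∀ a, ∀ y ∈ t.target ∩ t.symm ⁻¹' p.source,
      S.metricL t y₀ (ξ a y) = fderiv 𝕜 (fun z => p (t.symm z) a) y := fun a y hy => by
    ext1 v; exact hsharp _ _
  have hξ₁ : ∀ a, ∀ y ∈ t.target ∩ t.symm ⁻¹' p.source, ∀ v, S.metricL t y₀ (ξ a y) v =
        fderiv 𝕜 (fun z => p (t.symm z)) y v a := fun a y hy v => by
    rw [hξ₀ a y hy]
    have := (hasFDerivAt_pi'.mp
      (differentiableAt_transition ht.1 hp.1 hy.1 hy.2).hasFDerivAt) a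
    rw [this.fderiv]
    rfl
  have hcomp : ∀ x ∈ t.source, x ∈ p.source → ∀ a,
      components t x ((S.flat x).symm (dcoord p a x)) = ξ a (t x) := by
    intro x hxt hxp a
    refine S.components_flat_symm ht hp.1 hxt hxp a fun v => ?_
    rw [S.metricL_eq ht (t.map_source hxt) hy₀]
    refine hξ₁ a _ ⟨t.map_source hxt, ?_⟩ v
    rwa [Set.mem_preimage, t.left_inv hxt]
  have hframe : ∀ x (hxp : x ∈ p.source), ∃ X, IsDualFrame (S.metric x) (S.mul x) (S.e x) (S.E x)
      X (fun a => (S.flat x).symm (dcoord p a x)) (fun a => dcoord p a x) G := by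
    intro x hxp
    obtain ⟨y, hy, rfl⟩ : ∃ y ∈ p.target, p.symm y = x := ⟨p x, p.map_source hxp, p.left_inv hxp⟩
    exact ⟨_, S.isDualFrame hp hy⟩
  have hE : ∀ x ∈ t.source, S.EComp t (t x) = components t x (S.E x) := by
    intro x hx
    rw [EComp, t.left_inv hx]
  refine ⟨ξ, ?_, hξ₁⟩
  exact
  { isOpen := hΩ
    smooth_mul := (S.contDiffOn_mulL hS ht.1).mono Set.inter_subset_left
    smooth_E := (hS.smooth_E t ht.1).mono Set.inter_subset_left
    smooth_grad := hξC
    symm := S.metricL_symm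
    comm := fun y _ => S.mulL_comm
    assoc := fun y hy => S.mulL_assoc ht.1 hy.1
    unit := fun y hy => S.mulL_unit ht.1 hy.1
    inv := fun y hy => by
      rw [S.metricL_eq ht hy₀ hy.1]
      exact S.metricL_inv ht.1 hy.1
    cov := fun y hy => S.fderiv_mulL_symm hS ht hy.1
    euler := fun y hy => S.fderiv_mulL_euler hS ht hy.1
    conformal := fun y hy => by
      rw [S.metricL_eq ht hy₀ hy.1]
      exact S.metricL_euler hS ht hy.1
    hess := fun y hy a => hessian_symm hΩ (hpta a) _ hy
      (((hξC a).differentiableOn (by simp)).differentiableAt (hΩ.mem_nhds hy)) (hξ₀ a)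
    gram := fun y hy a b => by
      have hx := t.map_target hy.1
      obtain ⟨X, h⟩ := hframe _ hy.2
      have hG : S.metric (t.symm y) (S.mul _ (S.E _) ((S.flat _).symm (dcoord p a _)))
          ((S.flat _).symm (dcoord p b _)) = G a b := by
        rw [S.invariant, S.metric_symm]
        exact h.gram a b
      rwa [S.metric_mul_eq ht.1 hx, hcomp _ hx hy.2, hcomp _ hx hy.2, ← hE _ hx,
        t.right_inv hy.1, ← S.metricL_eq ht hy₀ hy.1] at hG
    span := fun y hy => by
      have hx := t.map_target hy.1
      obtain ⟨X, h⟩ := hframe _ hy.2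
      refine Submodule.eq_top_iff'.mpr fun v => ?_
      obtain ⟨c, hc⟩ := h.exists_sum_mul_sharp (vec t y v)
      have hv := congrArg (components t (t.symm y)) hc
      rw [components_vec ht.1 hy.1, map_sum] at hv
      rw [← hv]
      refine Submodule.sum_mem _ fun a _ => ?_
      rw [map_smul]
      refine Submodule.smul_mem _ _ (Submodule.subset_span ⟨a, ?_⟩)
      have := hcomp _ hx hy.2 a
      rw [t.right_inv hy.1] at this
      simp only [mulL_apply, coordMul, ← this, EComp, vec_components ht.1 hy.1]
    sep := fun y hy z hz => by
      have hx := t.map_target hy.1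
      obtain ⟨X, h⟩ := hframe _ hy.2
      have hθ : ∀ b, dcoord p b (t.symm y) (vec t y z) = 0 := by
        intro b
        have h1 := hz b
        have h2 := hcomp _ hx hy.2 b
        rw [t.right_inv hy.1] at h2
        rwa [← h2, S.metricL_eq ht hy₀ hy.1, metricL_apply, coordMetric,
          vec_components ht.1 hy.1, S.metric_symm, metric_flat_symm] at h1
      have h0 : vec t y z = 0 := by
        rw [← h.expand (vec t y z)]
        simp [hθ]
      rw [← components_vec ht.1 hy.1 z, h0, map_zero] }

end Flat

end FrobeniusField

namespace FrobeniusField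

variable {𝕜 : Type*} [RCLike 𝕜] {n : ℕ} {M : Type*} [TopologicalSpace M]
  [ChartedSpace (Fin n → 𝕜) M] (S : FrobeniusField 𝕜 n M)
  {t p : OpenPartialHomeomorph M (Fin n → 𝕜)} {G : Matrix (Fin n) (Fin n) 𝕜}

theorem cotConst_eq (ht : IsCoord t) {τ : Fin n → 𝕜} (hτ : τ ∈ t.target) (α β γ : Fin n) :
    S.cotConst t α β γ τ = S.metricL t τ (S.mulL t τ
      (components t _ ((S.flat (t.symm τ)).symm (dcoord t α (t.symm τ))))
      (components t _ ((S.flat (t.symm τ)).symm (dcoord t β (t.symm τ))))) (Pi.single γ 1) := by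
  have h := S.metric_mul_eq ht (t.map_target hτ)
    ((S.flat (t.symm τ)).symm (dcoord t α (t.symm τ)))
    ((S.flat (t.symm τ)).symm (dcoord t β (t.symm τ))) (frame t γ τ)
  rw [t.right_inv hτ, frame, components_vec ht hτ] at h
  exact h

/-- The change of coordinates of the tensor `c^{αβ}_γ`, in terms of the gradients of `p`. -/
theorem sum_jac_cotConst (ht : S.IsFlatCoord t) (hp : IsCoord p) {y : Fin n → 𝕜}
    (hy : y ∈ p.target) (hyt : p.symm y ∈ t.source) {ξ : Fin n → Fin n → 𝕜}
    (hξ : ∀ a v, S.metricL t (t (p.symm y)) (ξ a) v =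
      fderiv 𝕜 (fun z => p (t.symm z)) (t (p.symm y)) v a) (a b k : Fin n) :
    ∑ α, ∑ β, ∑ γ, jac t p γ k y * jac p t a α (t (p.symm y)) * jac p t b β (t (p.symm y)) *
      S.cotConst t α β γ (t (p.symm y)) =
    S.metricL t (t (p.symm y)) (S.mulL t (t (p.symm y)) (ξ a) (ξ b))
      (fderiv 𝕜 (fun z => t (p.symm z)) y (Pi.single k 1)) := by
  have hτ := t.map_source hyt
  have hτp : t.symm (t (p.symm y)) ∈ p.source := by
    rw [t.left_inv hyt]; exact p.map_target hy
  have hjac : ∀ γ, jac t p γ k y = fderiv 𝕜 (fun z => t (p.symm z)) y (Pi.single k 1) γ :=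
    fun γ => jac_eq hp ht.1 hy hyt γ k
  have hjac' : ∀ a α, jac p t a α (t (p.symm y)) =
      fderiv 𝕜 (fun z => p (t.symm z)) (t (p.symm y)) (Pi.single α 1) a :=
    fun a α => jac_eq ht.1 hp hτ hτp a α
  generalize t (p.symm y) = τ at *
  generalize fderiv 𝕜 (fun z => t (p.symm z)) y (Pi.single k 1) = v at *
  set σ : Fin n → Fin n → 𝕜 := fun α =>
    components t _ ((S.flat (t.symm τ)).symm (dcoord t α (t.symm τ))) with hσ
  have hσv : ∀ α v, S.metricL t τ (σ α) v = v α := by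
    intro α v
    rw [metricL_apply, coordMetric, hσ]
    simp only [vec_components ht.1 hτ, metric_flat_symm]
    exact congrFun (components_vec ht.1 hτ v) α
  -- The chain rule `dp^a = ∑ (∂p^a/∂t^α) dt^α` with the index raised; `σ α` is the gradient of
  -- `t^α`.
  have hξσ : ∀ a, ξ a = ∑ α, jac p t a α τ • σ α := by
    intro a
    refine sub_eq_zero.mp (S.metricL_nondeg ht.1 hτ _ fun v => ?_)
    simp only [map_sub, map_sum, map_smul, sub_apply, sum_apply, smul_apply, hσv, hξ, smul_eq_mul,
      hjac']
    conv_lhs => enter [1]; rw [pi_eq_sum_univ' v]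
    simp only [map_sum, map_smul, Finset.sum_apply, Pi.smul_apply, smul_eq_mul]
    exact sub_eq_zero.mpr (Finset.sum_congr rfl fun _ _ => _root_.mul_comm _ _)
  rw [hξσ a, hξσ b]
  conv_rhs => rw [pi_eq_sum_univ' v]
  simp only [map_sum, map_smul, sum_apply, smul_apply, smul_eq_mul, Finset.mul_sum,
    S.cotConst_eq ht.1 hτ, hjac]
  refine Eq.symm ((Finset.sum_congr rfl fun _ _ => Finset.sum_comm).trans
    (Finset.sum_comm.trans (Finset.sum_congr rfl fun α _ => Finset.sum_comm.trans
      (Finset.sum_congr rfl fun β _ => Finset.sum_congr rfl fun γ _ => ?_))))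
  simp only [hσ]
  ring

end FrobeniusField

end AlmostDuality

end

open AlmostDuality

/-! ### Assembly of the main theorem -/

theorem mainTheorem2 {𝕜 : Type*} [RCLike 𝕜] {n : ℕ} {M : Type*} [TopologicalSpace M]
    [ChartedSpace (Fin n → 𝕜) M] [IsManifold 𝓘(𝕜, Fin n → 𝕜) ∞ M]
    (S : FrobeniusField 𝕜 n M) (d : 𝕜) (hS : S.IsFrobeniusManifold d)
    (t : OpenPartialHomeomorph M (Fin n → 𝕜)) (ht : S.IsFlatCoord t)
    (p : OpenPartialHomeomorph M (Fin n → 𝕜)) (G : Matrix (Fin n) (Fin n) 𝕜)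
    (hp : S.IsInterFlatCoord p G)
    (V : Set (Fin n → 𝕜)) (hVo : IsOpen V) (hVc : Convex ℝ V) (hVn : V.Nonempty)
    (hVp : V ⊆ p.target) (hVt : ∀ y ∈ V, p.symm y ∈ t.source) :
    G.IsSymm ∧ IsUnit G.det ∧
    ∃ F : (Fin n → 𝕜) → 𝕜, ContDiffOn 𝕜 ∞ F V ∧
      (∀ y ∈ V, ∀ i j k, third F i j k y =
        ∑ a, ∑ b, ∑ α, ∑ β, ∑ γ, G⁻¹ i a * G⁻¹ j b * jac t p γ k y *
          jac p t a α (t (p.symm y)) * jac p t b β (t (p.symm y)) *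
          S.cotConst t α β γ (t (p.symm y))) ∧
      (∀ y ∈ V, ∀ i j k, S.starConst p i j k y = ∑ l, G k l * third F l i j y) ∧
      (∀ y ∈ V, ∀ i j k l,
        ∑ a, ∑ b, third F i j a y * G a b * third F b k l y =
          ∑ a, ∑ b, third F l j a y * G a b * third F b k i y) ∧
      (d ≠ 1 →
        (∃ q : Fin n → 𝕜,
          (∀ y ∈ V, ∀ a, S.EComp p y a = (1 - d) / 2 * (y a - q a)) ∧
          ∀ y ∈ V, ∑ a, (y a - q a) * pd a F y =
            2 * F y + 1 / (1 - d) * ∑ a, ∑ b, G⁻¹ a b * (y a - q a) * (y b - q b)) ∧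
        ((∀ y ∈ V, ∀ a, S.EComp p y a = (1 - d) / 2 * y a) →
          ∀ y ∈ V, ∑ a, y a * pd a F y =
            2 * F y + 1 / (1 - d) * ∑ a, ∑ b, G⁻¹ a b * y a * y b)) := by
  obtain ⟨y₀, hy₀⟩ := hVn
  have hτ₀ : t (p.symm y₀) ∈ t.target := t.map_source (hVt y₀ hy₀)
  have hD := fun y hy => S.isDualFrame hp (hVp (a := y) hy)
  have hGsymm : G.IsSymm := (hD y₀ hy₀).isSymm
  have hGinv : ∀ i j, G⁻¹ i j = G⁻¹ j i := fun i j => by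
    conv_lhs => rw [← hGsymm.eq, ← Matrix.transpose_nonsing_inv, Matrix.transpose_apply]
  obtain ⟨ξ, hFS, hξ⟩ := S.exists_flatSystem hS ht hp hτ₀
  set η := S.metricL t (t (p.symm y₀)) with hη
  set ψ : (Fin n → 𝕜) → (Fin n → 𝕜) := fun z => t (p.symm z) with hψdef
  have hψ : ContDiffOn 𝕜 ∞ ψ V :=
    (contDiffOn_transition hp.1 ht.1).mono fun z hz => ⟨hVp hz, hVt z hz⟩
  have hmaps : Set.MapsTo ψ V (t.target ∩ t.symm ⁻¹' p.source) := fun z hz =>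
    ⟨t.map_source (hVt z hz), by
      rw [Set.mem_preimage, hψdef, t.left_inv (hVt z hz)]; exact p.map_target (hVp hz)⟩
  have hηψ : ∀ z ∈ V, S.metricL t (ψ z) = η := fun z hz => S.metricL_eq ht (hmaps hz).1 hτ₀
  have hcomp : ∀ z ∈ V, ∀ a, components t (p.symm z)
      ((S.flat (p.symm z)).symm (dcoord p a (p.symm z))) = ξ a (ψ z) := fun z hz a =>
    S.components_flat_symm ht hp.1 (hVt z hz) (p.map_target (hVp hz)) a fun v => by
      rw [hηψ z hz]; exact hξ a _ (hmaps hz) v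
  -- The components in the coordinates `p` of the closed one-form `<ξ a · ξ b, ·>`; lowering `a` and
  -- `b` by the constant matrix `G⁻¹` keeps it closed.
  set g : Fin n → Fin n → Fin n → (Fin n → 𝕜) → 𝕜 := fun a b k z =>
    η (S.mulL t (ψ z) (ξ a (ψ z)) (ξ b (ψ z))) (fderiv 𝕜 ψ z (Pi.single k 1)) with hg
  have hgC : ∀ a b k, ContDiffOn 𝕜 ∞ (g a b k) V := fun a b k =>
    hFS.contDiffOn_pullback hVo hψ hmaps a b _
  have hgcl : ∀ y ∈ V, ∀ a b k l, pd l (g a b k) y = pd k (g a b l) y := fun y hy a b k l =>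
    hFS.fderiv_pullback_symm hVo hψ hmaps a b hy _ _
  set Φ : Fin n → Fin n → Fin n → (Fin n → 𝕜) → 𝕜 := fun i j k z =>
    ∑ a, ∑ b, G⁻¹ i a * G⁻¹ j b * g a b k z with hΦ
  have hΦC : ∀ i j k, ContDiffOn 𝕜 ∞ (Φ i j k) V := fun i j k =>
    ContDiffOn.sum fun a _ => ContDiffOn.sum fun b _ => contDiffOn_const.mul (hgC a b k)
  have hΦcl : ∀ y ∈ V, ∀ i j k l, pd l (Φ i j k) y = pd k (Φ i j l) y := by
    intro y hy i j k l
    have hpd : ∀ k l, pd l (Φ i j k) y = ∑ a, ∑ b, G⁻¹ i a * G⁻¹ j b * pd l (g a b k) y := by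
      intro k l
      have hd : ∀ a b, HasFDerivAt (g a b k) (fderiv 𝕜 (g a b k) y) y := fun a b =>
        (((hgC a b k).differentiableOn (by simp)).differentiableAt (hVo.mem_nhds hy)).hasFDerivAt
      refine (pd_eq_of_hasFDerivAt (HasFDerivAt.fun_sum (u := Finset.univ) fun a _ =>
        HasFDerivAt.fun_sum (u := Finset.univ) fun b _ =>
          (hd a b).const_mul (G⁻¹ i a * G⁻¹ j b)) l).trans ?_
      simp [pd]
    rw [hpd, hpd]
    exact Finset.sum_congr rfl fun a _ => Finset.sum_congr rfl fun b _ => by rw [hgcl y hy]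
  have hΦdual : ∀ y ∈ V, ∀ i j k, Φ i j k y = dualTensor (S.metric (p.symm y)) (S.mul (p.symm y))
      (fun i => frame p i y) (fun a => (S.flat (p.symm y)).symm (dcoord p a (p.symm y)))
      G i j k := by
    intro y hy i j k
    refine Eq.trans ?_ (IsDualFrame.sum_sum_eq (η := S.metric (p.symm y))
      (m := S.mul (p.symm y)) (X := fun i => frame p i y)
      (Z := fun a => (S.flat (p.symm y)).symm (dcoord p a (p.symm y))) (G := G) i j k)
    refine Finset.sum_congr rfl fun a _ => Finset.sum_congr rfl fun b _ => ?_
    rw [S.metric_mul_eq ht.1 (hVt y hy), hcomp y hy, hcomp y hy, frame,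
      components_vec_of_mem hp.1 ht.1 (hVp hy) (hVt y hy)]
    simp only [hg, ← hηψ y hy]
    rfl
  have hΦjac : ∀ y ∈ V, ∀ i j k, Φ i j k y =
      ∑ a, ∑ b, ∑ α, ∑ β, ∑ γ, G⁻¹ i a * G⁻¹ j b * jac t p γ k y *
          jac p t a α (t (p.symm y)) * jac p t b β (t (p.symm y)) *
          S.cotConst t α β γ (t (p.symm y)) := by
    intro y hy i j k
    refine Finset.sum_congr rfl fun a _ => Finset.sum_congr rfl fun b _ => ?_
    have h := S.sum_jac_cotConst ht hp.1 (hVp hy) (hVt y hy) (ξ := fun a => ξ a (ψ y))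
      (fun a v => by
        change S.metricL t (ψ y) _ _ = _
        rw [hηψ y hy]; exact hξ a _ (hmaps hy) v) a b k
    have hgab : g a b k y = _ := (by simp only [hg, ← hηψ y hy]; rfl : g a b k y = _).trans h.symm
    rw [hgab]
    simp only [Finset.mul_sum, mul_assoc]
  have hΦ12 : ∀ y ∈ V, ∀ i j k, Φ i j k y = Φ j i k y := fun y hy i j k => by
    rw [hΦdual y hy, hΦdual y hy, (hD y hy).dualTensor_swap₁₂]
  have hΦ23 : ∀ y ∈ V, ∀ i j k, Φ i j k y = Φ i k j y := fun y hy i j k => by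
    rw [hΦdual y hy, hΦdual y hy, (hD y hy).dualTensor_swap₂₃]
  have hstar : ∀ y ∈ V, ∀ i j k, S.starConst p i j k y = ∑ l, G k l * Φ l i j y := by
    intro y hy i j k
    simp only [hΦdual y hy]
    exact ((hD y hy).sum_mul_dualTensor i j k _ (S.mul_euler_star hp (hVp hy) _ _)).symm
  have hwdvv : ∀ y ∈ V, ∀ i j k l, ∑ a, ∑ b, Φ i j a y * G a b * Φ b k l y =
      ∑ a, ∑ b, Φ l j a y * G a b * Φ b k i y := by
    intro y hy i j k l
    simp only [hΦdual y hy]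
    exact (hD y hy).dualTensor_wdvv i j k l
  refine ⟨hGsymm, (hD y₀ hy₀).isUnit_det, ?_⟩
  -- For `d = 1` any potential will do; otherwise it must be chosen homogeneous around the zero `q`
  -- of the affine functions `E(p^a)`.
  by_cases hd : d = 1
  · obtain ⟨F, hF, hF3⟩ := exists_potential hVo hVc hΦC hΦ12 hΦ23 hΦcl
    refine ⟨F, hF, fun y hy i j k => by rw [hF3 y hy, hΦjac y hy], fun y hy i j k => ?_,
      fun y hy i j k l => ?_, fun h => absurd hd h⟩
    · simp only [hF3 y hy, hstar y hy]
    · simp only [hF3 y hy, hwdvv y hy i j k l]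
  have hd' : 1 - d ≠ 0 := sub_ne_zero.mpr (Ne.symm hd)
  have hEp : ∀ y ∈ V, ∀ a, S.EComp p y a = η (ξ a (ψ y)) (S.EComp t (ψ y)) := by
    intro y hy a
    have h := S.metric_flat_symm (p.symm y) (dcoord p a (p.symm y)) (S.E (p.symm y))
    rw [S.metric_eq ht.1 (hVt y hy), hcomp y hy] at h
    have hE : S.EComp t (ψ y) = components t (p.symm y) (S.E (p.symm y)) := by
      simp only [FrobeniusField.EComp]
      rw [t.left_inv (hVt y hy)]
    rw [hE, ← hηψ y hy]
    exact h.symm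
  -- In the coordinates `p` the differential of `p^a` is the `a`-th projection, because `ψ` inverts
  -- the transition from `t` to `p`.
  have hgrad : ∀ y ∈ V, ∀ a w, η (ξ a (ψ y)) (fderiv 𝕜 ψ y w) = w a := by
    intro y hy a w
    rw [hξ a _ (hmaps hy)]
    have h1 := (differentiableAt_transition ht.1 hp.1 (hmaps hy).1 (hmaps hy).2).hasFDerivAt
    have h2 := (differentiableAt_transition hp.1 ht.1 (hVp hy) (hVt y hy)).hasFDerivAt
    have h3 : (fun z => p (t.symm (ψ z))) =ᶠ[nhds y] id :=
      Filter.eventuallyEq_of_mem (hVo.mem_nhds hy) fun z hz => by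
        simp only [hψdef, t.left_inv (hVt z hz), p.right_inv (hVp hz), id]
    have h4 := ((h1.comp y h2).congr_of_eventuallyEq h3.symm).unique (hasFDerivAt_id y)
    exact congrFun (DFunLike.congr_fun h4 w) a
  have hconst : ∀ a, ∃ c, ∀ y ∈ V, S.EComp p y a - (1 - d) / 2 * y a = c := by
    intro a
    have hder : ∀ y ∈ V, HasFDerivAt
        (fun z => η (ξ a (ψ z)) (S.EComp t (ψ z)) - (1 - d) / 2 * z a)
        (0 : (Fin n → 𝕜) →L[𝕜] 𝕜) y := by
      intro y hy
      obtain ⟨L, hL, hLa⟩ := hFS.hasFDerivAt_euler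
        (differentiableAt_transition hp.1 ht.1 (hVp hy) (hVt y hy)) (hmaps hy) a
      have := hL.sub (((ContinuousLinearMap.proj a :
        (Fin n → 𝕜) →L[𝕜] 𝕜).hasFDerivAt (x := y)).const_mul ((1 - d) / 2))
      refine this.congr_fderiv ?_
      ext1 w
      have h := hLa w
      rw [hgrad y hy] at h
      simp [h]
    refine ⟨S.EComp p y₀ a - (1 - d) / 2 * y₀ a, fun y hy => ?_⟩
    rw [hEp y hy, hEp y₀ hy₀]
    exact hVo.is_const_of_fderiv_eq_zero hVc.isPreconnected
      (fun z hz => (hder z hz).differentiableAt.differentiableWithinAt)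
      (fun z hz => (hder z hz).fderiv) hy hy₀
  choose c hc using hconst
  obtain ⟨q, hq⟩ : ∃ q : Fin n → 𝕜, ∀ y ∈ V, ∀ a, S.EComp p y a = (1 - d) / 2 * (y a - q a) := by
    -- Solves `(1-d)/2 · y a + c a = (1-d)/2 · (y a - q a)` for `q a`.
    refine ⟨fun a => -(2 / (1 - d) * c a), fun y hy a => ?_⟩
    have e : (1 - d) / 2 * (2 / (1 - d)) = 1 := by field_simp
    linear_combination hc a y hy - c a * e
  have hhom : ∀ y ∈ V, ∀ j k, ∑ i, (y i - q i) * Φ i j k y = 2 * (1 / (1 - d)) * G⁻¹ j k := by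
    intro y hy j k
    have h := (hD y hy).sum_euler_mul_dualTensor j k
    have hθ : ∀ i, dcoord p i (p.symm y) (S.E (p.symm y)) = (1 - d) / 2 * (y i - q i) :=
      fun i => hq y hy i
    simp only [← hΦdual y hy, hθ, mul_assoc, ← Finset.mul_sum] at h
    rw [← h]
    field_simp
  obtain ⟨F, hF, hF3, hFq⟩ := exists_homogeneous_potential hVo hVc hΦC hΦ12 hΦ23 hΦcl q G⁻¹
    hGinv (1 / (1 - d)) hhom
  refine ⟨F, hF, fun y hy i j k => by rw [hF3 y hy, hΦjac y hy], fun y hy i j k => ?_,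
      fun y hy i j k l => ?_, fun _ => ⟨⟨q, hq, hFq⟩, fun h0 => ?_⟩⟩
  · simp only [hF3 y hy, hstar y hy]
  · simp only [hF3 y hy, hwdvv y hy i j k l]
  -- Comparing the two formulas for `E(p^a)` at the single point `y₀` gives `q = 0`, so the same `F`
  -- satisfies the normalized equation.
  · have hq0 : ∀ a, q a = 0 := by
      intro a
      have h1 := h0 y₀ hy₀ a
      rw [hq y₀ hy₀ a] at h1
      have h2 := mul_left_cancel₀ (div_ne_zero hd' two_ne_zero) h1
      linear_combination -h2
    simpa only [hq0, sub_zero] using hFq
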